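/- For $\sigma\in\mathbb R$ let $H^\sigma(\mathbb R)$ be the $L^2$-based Sobolev space of real-valued tempered distributions $u$ on $\mathbb R$ with $(1+|k|^2)^{\sigma/2}\,\widehat u\in L^2(\mathbb R)$, normed by the $L^2$ norm of this function. For $\sigma>1/2$ every element of $H^\sigma(\mathbb R)$ is identified with its bounded continuous representative; subscripts $x$ denote distributional derivatives. Let $s>1/2$, let $\xi\in H^{s+3}(\mathbb R)$, and let $h\in 1+H^s(\mathbb R)$ with $\inf_{x\in\mathbb R}h(x)>0$. Then the linear operator $$A_{h,\xi}u \;=\; h(1+\xi_x^2)\,u+\Big[\tfrac12 h^2\xi_x u\Big]_x-\tfrac12 h^2\xi_x u_x-\Big[\tfrac13 h^3u_x\Big]_x$$ maps $H^{s+1}(\mathbb R)$ into $H^{s-1}(\mathbb R)$, and $A_{h,\xi}:H^{s+1}(\mathbb R)\to H^{s-1}(\mathbb R)$ is an isomorphism of normed spaces: it is bounded, bijective, and has a bounded inverse. (For $u\in H^{s+1}(\mathbb R)$ the functions $h,\xi_x,u,u_x$ are bounded and continuous, so the products are pointwise; the outer derivatives are taken in the sense of distributions.) -/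

import Mathlib

open scoped SchwartzMap LineDeriv FourierTransform ENNReal ContDiff
open scoped BoundedContinuousFunction
open MeasureTheory

noncomputable section

/-- A tempered distribution on the line is real-valued if it takes real values on real-valued
test functions. -/
def IsRealDistribution (T : 𝓢'(ℝ, ℂ)) : Prop :=
  ∀ φ : 𝓢(ℝ, ℂ), (∀ x, (φ x).im = 0) → (T φ).im = 0

/-- The real-valued tempered distributions in the `L²`-based Sobolev space of order `s`. -/
def sobolevSubmodule (s : ℝ) : Submodule ℝ 𝓢'(ℝ, ℂ) where
  carrier := {T | TemperedDistribution.MemSobolev s 2 T ∧ IsRealDistribution T}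
  zero_mem' := ⟨TemperedDistribution.memSobolev_fun_zero ℝ ℂ s 2, fun φ _ => by simp⟩
  add_mem' := fun {T S} hT hS => ⟨hT.1.add hS.1, fun φ hφ => by
    simp [hT.2 φ hφ, hS.2 φ hφ]⟩
  smul_mem' := fun c T hT => ⟨by simpa using hT.1.smul (c : ℂ), fun φ hφ => by
    simp [hT.2 φ hφ]⟩

/-- The Sobolev space `H^s(ℝ)` of real-valued (generalized) functions. It carries its own norm,
hence it is kept apart from the subspace of `𝓢'` with the subspace topology. -/
def RealSobolev (s : ℝ) : Type := sobolevSubmodule s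

namespace RealSobolev

variable {s : ℝ}

instance : AddCommGroup (RealSobolev s) := inferInstanceAs (AddCommGroup (sobolevSubmodule s))

instance : Module ℝ (RealSobolev s) := inferInstanceAs (Module ℝ (sobolevSubmodule s))

/-- The underlying tempered distribution. -/
def toDist : RealSobolev s →ₗ[ℝ] 𝓢'(ℝ, ℂ) := (sobolevSubmodule s).subtype

theorem toDist_injective : Function.Injective (toDist (s := s)) :=
  (sobolevSubmodule s).injective_subtype

theorem memSobolev (u : RealSobolev s) : TemperedDistribution.MemSobolev s 2 (toDist u) := u.2.1

theorem isReal (u : RealSobolev s) : IsRealDistribution (toDist u) := u.2.2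

theorem toTemperedDistribution_injective {p : ℝ≥0∞} [Fact (1 ≤ p)] :
    Function.Injective (fun f : Lp ℂ p (volume : Measure ℝ) => (f : 𝓢'(ℝ, ℂ))) :=
  LinearMap.ker_eq_bot.mp (Lp.ker_toTemperedDistributionCLM_eq_bot (E := ℝ) (F := ℂ))

theorem exists_besselL2 (u : RealSobolev s) : ∃ f : Lp ℂ 2 (volume : Measure ℝ),
    TemperedDistribution.besselPotential ℝ ℂ s (toDist u) =
      Lp.toTemperedDistributionCLM ℂ volume 2 f := memSobolev u

/-- The `L²` function `𝓕⁻ ((1 + |k|²)^{s/2} 𝓕 u)` for `u ∈ H^s`. -/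
def besselFun (u : RealSobolev s) : Lp ℂ 2 (volume : Measure ℝ) := (exists_besselL2 u).choose

theorem besselFun_spec (u : RealSobolev s) :
    TemperedDistribution.besselPotential ℝ ℂ s (toDist u) =
      Lp.toTemperedDistributionCLM ℂ volume 2 (besselFun u) := (exists_besselL2 u).choose_spec

/-- The map `besselFun` as a linear map from `H^s` to `L²`. -/
def besselL2 : RealSobolev s →ₗ[ℝ] Lp ℂ 2 (volume : Measure ℝ) where
  toFun := besselFun
  map_add' u v := by
    apply toTemperedDistribution_injective
    change Lp.toTemperedDistributionCLM ℂ volume 2 _ = Lp.toTemperedDistributionCLM ℂ volume 2 _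
    rw [map_add, ← besselFun_spec, ← besselFun_spec, ← besselFun_spec, map_add, map_add]
  map_smul' c u := by
    apply toTemperedDistribution_injective
    change Lp.toTemperedDistributionCLM ℂ volume 2 _ = Lp.toTemperedDistributionCLM ℂ volume 2 _
    rw [RingHom.id_apply, ContinuousLinearMap.map_smul_of_tower, ← besselFun_spec,
      ← besselFun_spec, map_smul, ContinuousLinearMap.map_smul_of_tower]

theorem besselL2_spec (u : RealSobolev s) :
    TemperedDistribution.besselPotential ℝ ℂ s (toDist u) = (besselL2 u : 𝓢'(ℝ, ℂ)) :=
  besselFun_spec u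

theorem besselL2_injective : Function.Injective (besselL2 (s := s)) := by
  intro u v huv
  apply toDist_injective
  have h : TemperedDistribution.besselPotential ℝ ℂ s (toDist u) =
      TemperedDistribution.besselPotential ℝ ℂ s (toDist v) := by
    rw [besselL2_spec, besselL2_spec, huv]
  have h2 := congrArg (TemperedDistribution.besselPotential ℝ ℂ (-s)) h
  simpa using h2

/-- The Sobolev norm `‖u‖_{H^s} = ‖(1 + |k|²)^{s/2} û‖_{L²}`. -/
instance : NormedAddCommGroup (RealSobolev s) :=
  NormedAddCommGroup.induced (RealSobolev s) (Lp ℂ 2 (volume : Measure ℝ)) besselL2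
    besselL2_injective

instance : NormedSpace ℝ (RealSobolev s) :=
  NormedSpace.induced ℝ (RealSobolev s) (Lp ℂ 2 (volume : Measure ℝ)) besselL2

/-- The distributional derivative `u ↦ u_x` from `H^s` to `H^{s-1}`. -/
def dx (u : RealSobolev s) : RealSobolev (s - 1) :=
  ⟨∂_{(1 : ℝ)} (toDist u), (memSobolev u).lineDerivOp, fun φ hφ => by
    rw [TemperedDistribution.lineDerivOp_apply_apply]
    apply isReal u
    intro x
    have hd : HasDerivAt (fun y => (φ y).im) (deriv φ x).im x :=
      Complex.imCLM.hasFDerivAt.comp_hasDerivAt x φ.differentiableAt.hasDerivAt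
    have h0 : (deriv φ x).im = 0 := by
      rw [funext hφ] at hd
      exact hd.unique (hasDerivAt_const x 0)
    have h1 : (∂_{(1 : ℝ)} φ) x = deriv φ x := by
      rw [SchwartzMap.lineDerivOp_apply_eq_fderiv, fderiv_apply_one_eq_deriv]
    simp [h1, h0]⟩

end RealSobolev

/-- The tempered distribution `φ ↦ ∫ f φ dx` given by a bounded continuous function `f`. -/
def BoundedContinuousFunction.toDist (f : ℝ →ᵇ ℝ) : 𝓢'(ℝ, ℂ) :=
  ((f.memLp_top (μ := volume)).ofReal (K := ℂ)).toLp

theorem BoundedContinuousFunction.toDist_apply (f : ℝ →ᵇ ℝ) (φ : 𝓢(ℝ, ℂ)) :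
    f.toDist φ = ∫ x, φ x * (f x : ℂ) := by
  rw [BoundedContinuousFunction.toDist, Lp.toTemperedDistribution_apply]
  apply integral_congr_ae
  filter_upwards [((f.memLp_top (μ := volume)).ofReal (K := ℂ)).coeFn_toLp] with x hx
  rw [hx]
  rfl

theorem BoundedContinuousFunction.toDist_injective :
    Function.Injective BoundedContinuousFunction.toDist := by
  intro f g hfg
  have h := RealSobolev.toTemperedDistribution_injective hfg
  rw [MemLp.toLp_eq_toLp_iff] at h
  have h2 : (f : ℝ → ℝ) =ᵐ[volume] g := by
    filter_upwards [h] with x hx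
    exact_mod_cast hx
  exact DFunLike.coe_injective
    ((Continuous.ae_eq_iff_eq volume f.continuous g.continuous).mp h2)

namespace RealSobolev

variable {s : ℝ}

/-- Sobolev imbedding: for `s > 1/2` every element of `H^s(ℝ)` is given by a unique bounded
continuous function. -/
theorem existsUnique_rep (hs : 1 / 2 < s) (u : RealSobolev s) :
    ∃! f : ℝ →ᵇ ℝ, f.toDist = toDist u := by
  obtain ⟨v, hv⟩ := (memSobolev u).fourier_memL1 (by simp; linarith)
  have hvint : Integrable (v : ℝ → ℂ) := L1.integrable_coeFn v
  have hL : Continuous fun p : ℝ × ℝ => (-innerₗ ℝ : ℝ →ₗ[ℝ] ℝ →ₗ[ℝ] ℝ) p.1 p.2 := by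
    simp only [LinearMap.neg_apply, innerₗ_apply_apply]
    fun_prop
  have hcont : Continuous (𝓕⁻ (v : ℝ → ℂ)) :=
    VectorFourier.fourierIntegral_continuous Real.continuous_fourierChar hL hvint
  have hbdd : ∀ x, ‖𝓕⁻ (v : ℝ → ℂ) x‖ ≤ ∫ k, ‖v k‖ := fun x =>
    VectorFourier.norm_fourierIntegral_le_integral_norm _ _ _ _ x
  have hrep : ∀ φ : 𝓢(ℝ, ℂ), toDist u φ = ∫ x, φ x * 𝓕⁻ (v : ℝ → ℂ) x := by
    intro φ
    have h1 : toDist u φ = (v : 𝓢'(ℝ, ℂ)) (𝓕⁻ φ) := by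
      rw [← hv, TemperedDistribution.fourier_apply, FourierTransform.fourier_fourierInv_eq]
    rw [h1, Lp.toTemperedDistribution_apply]
    have h2 := VectorFourier.integral_fourierIntegral_smul_eq_flip (μ := volume) (ν := volume)
      (L := (-innerₗ ℝ : ℝ →ₗ[ℝ] ℝ →ₗ[ℝ] ℝ)) Real.continuous_fourierChar hL φ.integrable hvint
    have h3 : (-innerₗ ℝ : ℝ →ₗ[ℝ] ℝ →ₗ[ℝ] ℝ).flip = -innerₗ ℝ := by
      ext; simp
    rw [h3] at h2
    simpa only [SchwartzMap.fourierInv_coe] using! h2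
  have himcont : Continuous fun x => (𝓕⁻ (v : ℝ → ℂ) x).im := Complex.continuous_im.comp hcont
  have him : ∀ x, (𝓕⁻ (v : ℝ → ℂ) x).im = 0 := by
    have hae : ∀ᵐ x, (𝓕⁻ (v : ℝ → ℂ) x).im = 0 := by
      apply ae_eq_zero_of_integral_contDiff_smul_eq_zero himcont.locallyIntegrable
      intro g g_smooth g_cpt
      have hg₁ : HasCompactSupport (Complex.ofRealCLM ∘ g) := g_cpt.comp_left rfl
      have hg₂ : ContDiff ℝ ∞ (Complex.ofRealCLM ∘ g) := by fun_prop
      have h0 : (toDist u (hg₁.toSchwartzMap hg₂)).im = 0 := isReal u _ fun x => by simp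
      rw [hrep] at h0
      have hint : Integrable (fun x => (hg₁.toSchwartzMap hg₂) x * 𝓕⁻ (v : ℝ → ℂ) x) := by
        apply Integrable.mul_bdd (c := ∫ k, ‖v k‖) (SchwartzMap.integrable _)
          hcont.aestronglyMeasurable
        exact Filter.Eventually.of_forall hbdd
      have h1 := integral_im hint
      simp only [RCLike.im_to_complex] at h1
      rw [h0] at h1
      rw [← h1]
      apply integral_congr_ae
      filter_upwards with x
      simp
    exact congrFun ((Continuous.ae_eq_iff_eq volume himcont continuous_const).mp hae)
  let f : ℝ →ᵇ ℝ := BoundedContinuousFunction.ofNormedAddCommGroup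
    (fun x => (𝓕⁻ (v : ℝ → ℂ) x).re) (Complex.continuous_re.comp hcont) (∫ k, ‖v k‖)
    fun x => (Complex.abs_re_le_norm _).trans (hbdd x)
  have hf : f.toDist = toDist u := by
    ext φ
    rw [BoundedContinuousFunction.toDist_apply, hrep]
    congr 1
    ext1 x
    congr 1
    exact Complex.ext rfl (by simp [him x])
  exact ⟨f, hf, fun g hg => BoundedContinuousFunction.toDist_injective (hg.trans hf.symm)⟩

/-- The bounded continuous representative of an element of `H^s(ℝ)`, `s > 1/2`. -/
def rep (hs : 1 / 2 < s) (u : RealSobolev s) : ℝ →ᵇ ℝ := (existsUnique_rep hs u).choose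

theorem toDist_rep (hs : 1 / 2 < s) (u : RealSobolev s) : (rep hs u).toDist = toDist u :=
  (existsUnique_rep hs u).choose_spec.1

/-- `A_{h,ξ} u = h (1 + ξ_x²) u + [½ h² ξ_x u]_x - ½ h² ξ_x u_x - [⅓ h³ u_x]_x` as a tempered
distribution, for `ξ ∈ H^{s+3}` and `u ∈ H^{s+1}` with `s > 1/2`. Here `h`, `ξ_x`, `u`, `u_x` are
bounded continuous functions, so the products are pointwise products; the outer derivatives are
distributional. -/
def opA (hs : 1 / 2 < s) (h : ℝ →ᵇ ℝ) (ξ : RealSobolev (s + 3)) (u : RealSobolev (s + 1)) :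
    𝓢'(ℝ, ℂ) :=
  let ξx : ℝ →ᵇ ℝ := rep (by linarith : 1 / 2 < s + 3 - 1) (dx ξ)
  let u₀ : ℝ →ᵇ ℝ := rep (by linarith : 1 / 2 < s + 1) u
  let ux : ℝ →ᵇ ℝ := rep (by linarith : 1 / 2 < s + 1 - 1) (dx u)
  (h * (1 + ξx ^ 2) * u₀).toDist
    + ∂_{(1 : ℝ)} ((1 / 2 : ℝ) • (h ^ 2 * ξx * u₀)).toDist
    - ((1 / 2 : ℝ) • (h ^ 2 * ξx * ux)).toDist
    - ∂_{(1 : ℝ)} ((1 / 3 : ℝ) • (h ^ 3 * ux)).toDist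

end RealSobolev

end

noncomputable section

open scoped Convolution

/-! Put `a = h(1 + ξ_x²)`, `b = -½h²ξ_x`, `c = ⅓h³`. The operator is the symmetric divergence form
`u ↦ (a u + b u_x) - (b u + c u_x)_x`, and completing the square gives `a u² + 2b u p + c p² = h u²
+ h(ξ_x u - h p/2)² + h³p²/12`. Since `h` is bounded below, the form is coercive on `H¹`. As `s - 1
> -1`, Lax-Milgram yields a weak solution in `H¹` for every right-hand side `f ∈ H^{s-1}`
(`exists_weak_solution`), and coercivity yields uniqueness (`eq_zero_of_weak_solution`).

Regularity is a bootstrap on the flux `w = b u + c u_x`. Since `w_x = (a u + b u_x) - f`, the flux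
gains one derivative, up to order `s`, and `u_x = 3(w - b u)/h³` passes the gain to `u`
(`memSobolev_step`). Finitely many steps lead from `H¹` to `H^{s+1}`.

The bootstrap needs `H^r`, `r > 1/2`, to be closed under products and under division by `h`, also
for fractional `r`. Division is the delicate point: for a constant `M` above `h`, the function `1 -
h/M` is at most some `q < 1` in the sup norm, which says nothing directly about its Sobolev operator
norm. The tame estimate `‖F²‖ ≤ C ‖F‖_{L²}^θ ‖F‖^{2-θ}` in `H^r` (`exists_mul`) closes this gap.
Under repeated squaring the `L²` norms decay doubly exponentially with base 2, while the recursion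
for the Sobolev norms only has exponent `2 - θ < 2`. Hence some power of the multiplication operator
has norm below one, and a Neumann series applies (`isUnit_one_sub`).

Continuity comes from the closed graph theorem, all spaces being continuously embedded in `𝓢'`; the
inverse is bounded by the open mapping theorem. -/

/-! ### Real-valued distributions and real `L²` functions. -/

/-- A real-valued Schwartz function, viewed as a complex-valued one. -/
def schwartzOfReal : 𝓢(ℝ, ℝ) →L[ℝ] 𝓢(ℝ, ℂ) := SchwartzMap.postcompCLM Complex.ofRealCLM

@[simp]
theorem schwartzOfReal_apply (φ : 𝓢(ℝ, ℝ)) (x : ℝ) : schwartzOfReal φ x = (φ x : ℂ) := rfl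

theorem deriv_schwartzOfReal (φ : 𝓢(ℝ, ℝ)) :
    ∂_{(1 : ℝ)} (schwartzOfReal φ) = schwartzOfReal (∂_{(1 : ℝ)} φ) := by
  ext x
  rw [schwartzOfReal_apply, SchwartzMap.lineDerivOp_apply_eq_fderiv,
    SchwartzMap.lineDerivOp_apply_eq_fderiv, fderiv_apply_one_eq_deriv, fderiv_apply_one_eq_deriv]
  exact (φ.differentiableAt.hasDerivAt.ofReal_comp).deriv

/-- Complex linearity reduces to real test functions, by splitting `φ` into real and imaginary
parts. -/
theorem tempered_ext_real {T S : 𝓢'(ℝ, ℂ)}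
    (h : ∀ φ : 𝓢(ℝ, ℝ), T (schwartzOfReal φ) = S (schwartzOfReal φ)) : T = S := by
  ext φ
  let φ₁ : 𝓢(ℝ, ℝ) := SchwartzMap.postcompCLM Complex.reCLM φ
  let φ₂ : 𝓢(ℝ, ℝ) := SchwartzMap.postcompCLM Complex.imCLM φ
  have hφ : φ = schwartzOfReal φ₁ + Complex.I • schwartzOfReal φ₂ := by
    ext x
    simp only [add_apply, smul_apply, schwartzOfReal_apply, smul_eq_mul]
    rw [mul_comm]
    exact (Complex.re_add_im (φ x)).symm
  rw [hφ, map_add, map_add, map_smul, map_smul, h, h]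

namespace IsRealDistribution

theorem iff_forall_schwartzOfReal {T : 𝓢'(ℝ, ℂ)} :
    IsRealDistribution T ↔ ∀ φ : 𝓢(ℝ, ℝ), (T (schwartzOfReal φ)).im = 0 := by
  refine ⟨fun h φ => h _ fun x => by simp, fun h φ hφ => ?_⟩
  have : φ = schwartzOfReal (SchwartzMap.postcompCLM Complex.reCLM φ) := by
    ext x
    exact Complex.ext rfl (hφ x)
  rw [this]
  exact h _

variable {T S : 𝓢'(ℝ, ℂ)}

theorem sub (hT : IsRealDistribution T) (hS : IsRealDistribution S) : IsRealDistribution (T - S) :=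
  fun φ hφ => by simp [hT φ hφ, hS φ hφ]

theorem lineDerivOp (hT : IsRealDistribution T) : IsRealDistribution (∂_{(1 : ℝ)} T) := by
  rw [iff_forall_schwartzOfReal]
  intro φ
  rw [TemperedDistribution.lineDerivOp_apply_apply, deriv_schwartzOfReal, ← map_neg]
  exact iff_forall_schwartzOfReal.mp hT _

theorem of_tendsto {u : ℕ → 𝓢'(ℝ, ℂ)} (hu : ∀ n, IsRealDistribution (u n))
    (h : Filter.Tendsto u Filter.atTop (nhds T)) : IsRealDistribution T := by
  intro φ hφ
  have h1 := (Complex.continuous_im.tendsto _).comp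
    (PointwiseConvergenceCLM.tendsto_iff_forall_tendsto.mp h φ)
  have h2 : Complex.im ∘ (fun n => u n φ) = fun _ => 0 := funext fun n => hu n φ hφ
  rw [h2] at h1
  exact tendsto_nhds_unique h1 tendsto_const_nhds

end IsRealDistribution

theorem ae_eq_of_forall_schwartz {f g : ℝ → ℂ} (hf : LocallyIntegrable f)
    (hg : LocallyIntegrable g)
    (h : ∀ φ : 𝓢(ℝ, ℂ), ∫ x, φ x * f x = ∫ x, φ x * g x) : f =ᵐ[volume] g := by
  apply ae_eq_of_integral_contDiff_smul_eq hf hg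
  intro φ φ_smooth φ_cpt
  have h₁ : HasCompactSupport (Complex.ofRealCLM ∘ φ) := φ_cpt.comp_left rfl
  have h₂ : ContDiff ℝ ∞ (Complex.ofRealCLM ∘ φ) := by fun_prop
  simpa using h (h₁.toSchwartzMap h₂)

theorem locallyIntegrable_ofReal {f : ℝ → ℝ} (hf : LocallyIntegrable f) :
    LocallyIntegrable (fun x => (f x : ℂ)) := fun x =>
  let ⟨U, hU, hfU⟩ := hf x
  ⟨U, hU, Integrable.ofReal hfU⟩

theorem ae_eq_of_forall_schwartz_real {f g : ℝ → ℝ} (hf : LocallyIntegrable f)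
    (hg : LocallyIntegrable g)
    (h : ∀ φ : 𝓢(ℝ, ℂ), ∫ x, φ x * (f x : ℂ) = ∫ x, φ x * (g x : ℂ)) : f =ᵐ[volume] g := by
  have h1 := ae_eq_of_forall_schwartz
    (f := fun x => (f x : ℂ)) (g := fun x => (g x : ℂ))
    (locallyIntegrable_ofReal hf) (locallyIntegrable_ofReal hg) h
  filter_upwards [h1] with x hx
  exact_mod_cast hx

theorem IsRealDistribution.of_integral {T : 𝓢'(ℝ, ℂ)} {f : ℝ → ℝ}
    (h : ∀ φ : 𝓢(ℝ, ℂ), T φ = ∫ x, φ x * (f x : ℂ)) : IsRealDistribution T := by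
  rw [IsRealDistribution.iff_forall_schwartzOfReal]
  intro φ
  simp only [h, schwartzOfReal_apply]
  have : ∫ x, (φ x : ℂ) * (f x : ℂ) = ((∫ x, φ x * f x : ℝ) : ℂ) := by
    rw [← integral_complex_ofReal]
    push_cast
    rfl
  rw [this, Complex.ofReal_im]

/-- The tempered distribution given by a real-valued square-integrable function. -/
def realL2Dist : Lp ℝ 2 (volume : Measure ℝ) →L[ℝ] 𝓢'(ℝ, ℂ) :=
  (Lp.toTemperedDistributionCLM ℂ volume 2).restrictScalars ℝ ∘L
    Complex.ofRealCLM.compLpL 2 volume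

theorem realL2Dist_apply (f : Lp ℝ 2 (volume : Measure ℝ)) (φ : 𝓢(ℝ, ℂ)) :
    realL2Dist f φ = ∫ x, φ x * (f x : ℂ) := by
  change Lp.toTemperedDistribution (Complex.ofRealCLM.compLp f) φ = _
  rw [Lp.toTemperedDistribution_apply]
  apply integral_congr_ae
  filter_upwards [Complex.ofRealCLM.coeFn_compLp f] with x hx
  simp [hx]

theorem memLp_two_locallyIntegrable (f : Lp ℝ 2 (volume : Measure ℝ)) :
    LocallyIntegrable f :=
  (Lp.memLp f).locallyIntegrable (by norm_num)

theorem realL2Dist_memSobolev (f : Lp ℝ 2 (volume : Measure ℝ)) :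
    TemperedDistribution.MemSobolev 0 2 (realL2Dist f) :=
  TemperedDistribution.memSobolev_zero_iff.mpr ⟨Complex.ofRealCLM.compLp f, rfl⟩

theorem realL2Dist_isReal (f : Lp ℝ 2 (volume : Measure ℝ)) : IsRealDistribution (realL2Dist f) :=
  IsRealDistribution.of_integral (realL2Dist_apply f)

theorem realL2Dist_re_apply (F : Lp ℂ 2 (volume : Measure ℝ)) (φ : 𝓢(ℝ, ℝ)) :
    realL2Dist (Complex.reCLM.compLp F) (schwartzOfReal φ) =
      (((F : 𝓢'(ℝ, ℂ)) (schwartzOfReal φ)).re : ℂ) := by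
  have hint : Integrable (fun x => (φ x : ℂ) * F x) :=
    MemLp.integrable_mul (p := 2) (q := 2) ((schwartzOfReal φ).memLp 2 volume) (Lp.memLp F)
  have h1 : (∫ x, (φ x : ℂ) * F x).re = ∫ x, φ x * (F x).re := by
    rw [← RCLike.re_to_complex, ← integral_re hint]
    simp
  rw [realL2Dist_apply, Lp.toTemperedDistribution_apply]
  simp only [schwartzOfReal_apply, smul_eq_mul]
  rw [h1, ← integral_complex_ofReal]
  apply integral_congr_ae
  filter_upwards [Complex.reCLM.coeFn_compLp F] with x hx
  simp [hx]

/-- On real test functions a real distribution sees only the real part of its `L²` representative,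
so that part already represents it. -/
theorem exists_realL2Dist_eq {T : 𝓢'(ℝ, ℂ)} (hT : TemperedDistribution.MemSobolev 0 2 T)
    (hr : IsRealDistribution T) : ∃ f, realL2Dist f = T := by
  obtain ⟨F, rfl⟩ := TemperedDistribution.memSobolev_zero_iff.mp hT
  refine ⟨Complex.reCLM.compLp F, tempered_ext_real fun φ => ?_⟩
  rw [realL2Dist_re_apply]
  exact Complex.ext rfl (IsRealDistribution.iff_forall_schwartzOfReal.mp hr φ).symm

/-! ### Bessel potentials of order two and bounded continuous functions as distributions. -/

namespace TemperedDistribution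

/-- The Fourier kernel is `e^{-2πikx}`, so `∂²` has symbol `-(2π)²k²`; this is the source of the
constant in `1 + k²`. -/
theorem besselPotential_two_eq (T : 𝓢'(ℝ, ℂ)) :
    besselPotential ℝ ℂ 2 T =
      T - (((2 * Real.pi) ^ 2)⁻¹ : ℝ) • (∂_{(1 : ℝ)} (∂_{(1 : ℝ)} T)) := by
  have h1 : fourierMultiplierCLM ℂ (fun _ : ℝ => (1 : ℂ)) T = T := by
    simp
  have h2 : ∂_{(1 : ℝ)} (∂_{(1 : ℝ)} T) =
      (-((2 * Real.pi) ^ 2) : ℝ) •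
        fourierMultiplierCLM ℂ (fun x : ℝ => ((‖x‖ ^ 2 : ℝ) : ℂ)) T := by
    rw [neg_smul, ← neg_smul, ← laplacian_eq_fourierMultiplierCLM,
      laplacian_eq_sum (OrthonormalBasis.singleton Unit ℝ)]
    simp
  have hpi : ((2 * Real.pi) ^ 2)⁻¹ * -((2 * Real.pi) ^ 2) = -1 := by
    rw [mul_neg, inv_mul_cancel₀ (by positivity)]
  rw [h2, smul_smul, besselPotential, hpi, neg_one_smul, sub_neg_eq_add]
  conv_rhs => enter [1]; rw [← h1]
  simp only [fourierMultiplierCLM_apply]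
  rw [← FourierTransform.fourierInv_add, ← add_apply,
    ← smulLeftCLM_add (by fun_prop) (by fun_prop)]
  congr 3
  ext x
  simp

/-- A distribution in `H^r` whose derivative is in `H^r` is in `H^{r+1}`. -/
theorem MemSobolev.add_one {r : ℝ} {T : 𝓢'(ℝ, ℂ)} (hT : MemSobolev r 2 T)
    (hT' : MemSobolev r 2 (∂_{(1 : ℝ)} T)) : MemSobolev (r + 1) 2 T := by
  -- Both `T` and `T''` lie in `H^{r-1}`, hence so does the order-two potential of `T`; undoing it
  -- gains two orders.
  have h1 : MemSobolev (r - 1) 2 (besselPotential ℝ ℂ 2 T) := by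
    rw [besselPotential_two_eq]
    refine (hT.mono (by linarith)).sub ?_
    exact hT'.lineDerivOp.smul ((((2 * Real.pi) ^ 2)⁻¹ : ℝ) : ℂ)
  rw [memSobolev_besselPotential_iff] at h1
  convert h1 using 1
  ring

end TemperedDistribution

namespace BoundedContinuousFunction

theorem toDist_add (f g : ℝ →ᵇ ℝ) : (f + g).toDist = f.toDist + g.toDist := by
  have hint (f : ℝ →ᵇ ℝ) (φ : 𝓢(ℝ, ℂ)) : Integrable (fun x => φ x * (f x : ℂ)) :=
    φ.integrable.mul_bdd (c := ‖f‖) (by fun_prop)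
      (.of_forall fun x => by simpa using f.norm_coe_le_norm x)
  ext φ
  change _ = f.toDist φ + g.toDist φ
  rw [toDist_apply, toDist_apply, toDist_apply, ← integral_add (hint f φ) (hint g φ)]
  congr 1
  ext x
  simp [mul_add]

theorem toDist_smul (c : ℝ) (f : ℝ →ᵇ ℝ) : (c • f).toDist = c • f.toDist := by
  ext φ
  change _ = c • f.toDist φ
  rw [toDist_apply, toDist_apply, ← integral_smul]
  congr 1
  ext x
  simp
  ring

theorem norm_toDist_apply_le (f : ℝ →ᵇ ℝ) (φ : 𝓢(ℝ, ℂ)) :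
    ‖f.toDist φ‖ ≤ ‖f‖ * ∫ x, ‖φ x‖ := by
  rw [toDist_apply, ← integral_const_mul]
  apply norm_integral_le_of_norm_le (φ.integrable.norm.const_mul _)
  refine .of_forall fun x => ?_
  rw [norm_mul, mul_comm]
  gcongr
  simpa using f.norm_coe_le_norm x

/-- The map `BoundedContinuousFunction.toDist` as a continuous linear map. -/
def toDistL : (ℝ →ᵇ ℝ) →L[ℝ] 𝓢'(ℝ, ℂ) where
  toFun := toDist
  map_add' := toDist_add
  map_smul' := toDist_smul
  cont := by
    apply PointwiseConvergenceCLM.continuous_of_continuous_eval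
    intro φ
    let L : (ℝ →ᵇ ℝ) →ₗ[ℝ] ℂ :=
      { toFun := fun f => f.toDist φ
        map_add' := fun f g => by rw [toDist_add]; rfl
        map_smul' := fun c f => by rw [toDist_smul]; rfl }
    exact (L.mkContinuous (∫ x, ‖φ x‖) fun f => by
      rw [mul_comm]; exact norm_toDist_apply_le f φ).continuous

theorem toDist_isReal (f : ℝ →ᵇ ℝ) : IsRealDistribution f.toDist :=
  IsRealDistribution.of_integral f.toDist_apply

end BoundedContinuousFunction

/-! ### Completeness, closed graph arguments and the Sobolev embedding. -/

namespace RealSobolev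

variable {s : ℝ}

/-- The element of `H^s` given by a real distribution of Sobolev regularity `s`. -/
def ofDist (T : 𝓢'(ℝ, ℂ)) (hT : TemperedDistribution.MemSobolev s 2 T)
    (hr : IsRealDistribution T) : RealSobolev s := ⟨T, hT, hr⟩

@[simp]
theorem toDist_ofDist (T : 𝓢'(ℝ, ℂ)) (hT : TemperedDistribution.MemSobolev s 2 T)
    (hr : IsRealDistribution T) : toDist (ofDist T hT hr) = T := rfl

@[simp]
theorem toDist_dx (u : RealSobolev s) : toDist (dx u) = ∂_{(1 : ℝ)} (toDist u) := rfl

theorem norm_eq (u : RealSobolev s) : ‖u‖ = ‖besselL2 u‖ := rfl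

theorem isometry_besselL2 : Isometry (besselL2 (s := s)) :=
  AddMonoidHomClass.isometry_of_norm _ fun _ => rfl

theorem toDist_eq (u : RealSobolev s) :
    toDist u = TemperedDistribution.besselPotential ℝ ℂ (-s)
      (Lp.toTemperedDistributionCLM ℂ volume 2 (besselL2 u)) := by
  symm
  rw [TemperedDistribution.besselPotential_neg_apply_eq_iff]
  exact besselL2_spec u

theorem continuous_toDist : Continuous (toDist (s := s)) := by
  have : (toDist (s := s) : RealSobolev s → 𝓢'(ℝ, ℂ)) = fun u =>
    TemperedDistribution.besselPotential ℝ ℂ (-s)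
      (Lp.toTemperedDistributionCLM ℂ volume 2 (besselL2 u)) := funext toDist_eq
  rw [this]
  exact (ContinuousLinearMap.continuous _).comp
    ((ContinuousLinearMap.continuous _).comp isometry_besselL2.continuous)

/-- The Bessel potential of order `-s` turns the `L²` limit into a distribution, and convergence in
`𝓢'` keeps it real. Completeness is what the closed graph theorem and the Neumann series rely on. -/
instance : CompleteSpace (RealSobolev s) := by
  apply Metric.complete_of_cauchySeq_tendsto
  intro u hu
  obtain ⟨g, hg⟩ := cauchySeq_tendsto_of_complete
    (isometry_besselL2.uniformContinuous.comp_cauchySeq hu)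
  let T := TemperedDistribution.besselPotential ℝ ℂ (-s) (Lp.toTemperedDistributionCLM ℂ volume 2 g)
  have hT : TemperedDistribution.besselPotential ℝ ℂ s T =
      Lp.toTemperedDistributionCLM ℂ volume 2 g := by
    rw [← TemperedDistribution.besselPotential_neg_apply_eq_iff]
  have hlim : Filter.Tendsto (fun n => toDist (u n)) Filter.atTop (nhds T) := by
    simp_rw [toDist_eq]
    exact ((TemperedDistribution.besselPotential ℝ ℂ (-s)).continuous.tendsto _).comp
      (((Lp.toTemperedDistributionCLM ℂ volume 2).continuous.tendsto _).comp hg)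
  let v : RealSobolev s := ofDist T ⟨g, hT⟩
    (IsRealDistribution.of_tendsto (fun n => isReal (u n)) hlim)
  have hv : besselL2 v = g :=
    toTemperedDistribution_injective ((besselL2_spec v).symm.trans hT)
  refine ⟨v, ?_⟩
  rw [isometry_besselL2.isEmbedding.tendsto_nhds_iff, hv]
  exact hg

/-- A linear map between Sobolev spaces, or from a Sobolev space to another Banach space, is
continuous as soon as it is continuous for a weaker Hausdorff topology on the target. -/
theorem continuous_of_comp_continuous {F : Type*} [NormedAddCommGroup F] [NormedSpace ℝ F]
    [CompleteSpace F] (A : RealSobolev s →ₗ[ℝ] F) {X : Type*} [TopologicalSpace X] [T2Space X]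
    (ι : F → X) (hι : Continuous ι) (hinj : Function.Injective ι)
    (h : Continuous fun u => ι (A u)) : Continuous A := by
  apply A.continuous_of_seq_closed_graph
  intro u x y hu hy
  exact hinj (tendsto_nhds_unique ((hι.tendsto y).comp hy) ((h.tendsto x).comp hu))

theorem rep_eq_of_toDist_eq (hs : 1 / 2 < s) {u : RealSobolev s} {f : ℝ →ᵇ ℝ}
    (h : f.toDist = toDist u) : rep hs u = f :=
  BoundedContinuousFunction.toDist_injective ((toDist_rep hs u).trans h.symm)

/-- The bounded continuous representative, as a continuous linear map. -/
def repL (hs : 1 / 2 < s) : RealSobolev s →L[ℝ] (ℝ →ᵇ ℝ) where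
  toFun := rep hs
  map_add' u v := rep_eq_of_toDist_eq hs (by
    rw [BoundedContinuousFunction.toDist_add, toDist_rep, toDist_rep, map_add])
  map_smul' c u := rep_eq_of_toDist_eq hs (by
    rw [BoundedContinuousFunction.toDist_smul, toDist_rep, map_smul]; rfl)
  cont := by
    let L : RealSobolev s →ₗ[ℝ] (ℝ →ᵇ ℝ) :=
      { toFun := rep hs
        map_add' := fun u v => rep_eq_of_toDist_eq hs (by
          rw [BoundedContinuousFunction.toDist_add, toDist_rep, toDist_rep, map_add])
        map_smul' := fun c u => rep_eq_of_toDist_eq hs (by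
          rw [BoundedContinuousFunction.toDist_smul, toDist_rep, map_smul]; rfl) }
    refine continuous_of_comp_continuous L BoundedContinuousFunction.toDist
      BoundedContinuousFunction.toDistL.continuous BoundedContinuousFunction.toDist_injective ?_
    exact continuous_toDist.congr fun u => (toDist_rep hs u).symm

end RealSobolev

/-! ### Young's inequality for convolutions. -/

section Young

theorem eLpNorm_two_sq {ε : Type*} [ENorm ε] (f : ℝ → ε) :
    eLpNorm f 2 volume ^ 2 = ∫⁻ x, ‖f x‖ₑ ^ 2 := by
  rw [eLpNorm_eq_lintegral_rpow_enorm_toReal (by norm_num) (by norm_num)]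
  simp only [ENNReal.toReal_ofNat]
  rw [← ENNReal.rpow_natCast, ← ENNReal.rpow_mul]
  norm_num

/-- Cauchy-Schwarz for the Lebesgue integral of products. -/
theorem sq_lintegral_mul_le {f g : ℝ → ℝ≥0∞} (hf : AEMeasurable f) (hg : AEMeasurable g) :
    (∫⁻ x, f x * g x) ^ 2 ≤ (∫⁻ x, f x ^ 2) * ∫⁻ x, g x ^ 2 := by
  have h := ENNReal.lintegral_mul_le_Lp_mul_Lq volume Real.HolderConjugate.two_two hf hg
  simp only [Pi.mul_apply, ENNReal.rpow_ofNat] at h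
  calc _ ≤ ((∫⁻ x, f x ^ 2) ^ (1 / 2 : ℝ) * (∫⁻ x, g x ^ 2) ^ (1 / 2 : ℝ)) ^ 2 := by gcongr
    _ = _ := by
      rw [mul_pow, ← ENNReal.rpow_natCast, ← ENNReal.rpow_natCast, ← ENNReal.rpow_mul,
        ← ENNReal.rpow_mul]
      norm_num

/-- Young's inequality `‖f ⋆ g‖₂ ≤ ‖f‖₁ ‖g‖₂`. -/
theorem eLpNorm_two_lconvolution_le {f g : ℝ → ℝ≥0∞} (hf : AEMeasurable f) (hg : AEMeasurable g) :
    eLpNorm (f ⋆ₗ g) 2 volume ≤ (∫⁻ x, f x) * eLpNorm g 2 volume := by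
  rw [← ENNReal.pow_le_pow_left_iff two_ne_zero, mul_pow, eLpNorm_two_sq, eLpNorm_two_sq]
  simp only [enorm_eq_self]
  -- Cauchy-Schwarz after splitting `f = f^{1/2} · f^{1/2}`; Tonelli then integrates the bound in
  -- `x`.
  have hpt (x : ℝ) : (f ⋆ₗ g) x ^ 2 ≤ (∫⁻ y, f y) * ∫⁻ y, f y * g (-y + x) ^ 2 := by
    have hgx : AEMeasurable (fun y => g (-y + x)) :=
      hg.comp_quasiMeasurePreserving (by
        simpa only [sub_eq_neg_add] using quasiMeasurePreserving_sub_left volume x)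
    have h := sq_lintegral_mul_le (f := fun y => f y ^ (1 / 2 : ℝ))
      (g := fun y => f y ^ (1 / 2 : ℝ) * g (-y + x)) (by fun_prop) (by fun_prop)
    have hsq (y : ℝ) : (f y ^ (1 / 2 : ℝ)) ^ 2 = f y := by
      rw [← ENNReal.rpow_natCast, ← ENNReal.rpow_mul]
      norm_num
    simpa only [mul_pow, hsq, ← mul_assoc, ← sq] using! h
  calc ∫⁻ x, (f ⋆ₗ g) x ^ 2
      ≤ ∫⁻ x, (∫⁻ y, f y) * ∫⁻ y, f y * g (-y + x) ^ 2 := lintegral_mono hpt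
    _ = (∫⁻ y, f y) * ∫⁻ x, (f ⋆ₗ (fun z => g z ^ 2)) x := by
      rw [lintegral_const_mul'']
      · rfl
      · exact aemeasurable_lconvolution hf (hg.pow_const 2)
    _ = (∫⁻ y, f y) * ((∫⁻ y, f y) * ∫⁻ z, g z ^ 2) := by
      congr 1
      simp only [lconvolution_def]
      rw [lintegral_lintegral_swap]
      · have (y : ℝ) : ∫⁻ x, f y * g (-y + x) ^ 2 = f y * ∫⁻ z, g z ^ 2 := by
          rw [lintegral_const_mul'', lintegral_add_left_eq_self (fun z => g z ^ 2)]
          exact (hg.comp_quasiMeasurePreserving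
            (quasiMeasurePreserving_add_left volume (-y))).pow_const 2
        simp_rw [this]
        rw [lintegral_mul_const'' _ hf]
      · simp only [Function.uncurry_def]
        fun_prop
    _ = _ := by ring

end Young

/-! ### Weights and the Fourier side of `H^s`. -/

/-- The weight `(1 + |k|²)^{s/2}`. -/
def bracket (s k : ℝ) : ℝ := (1 + ‖k‖ ^ 2) ^ (s / 2)

theorem bracket_pos (s k : ℝ) : 0 < bracket s k := by unfold bracket; positivity

theorem bracket_add (s t k : ℝ) : bracket (s + t) k = bracket s k * bracket t k := by
  rw [bracket, bracket, bracket, ← Real.rpow_add (by positivity), add_div]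

theorem bracket_neg_mul (s k : ℝ) : bracket (-s) k * bracket s k = 1 := by
  rw [← bracket_add]
  simp [bracket]

theorem one_le_bracket {s : ℝ} (hs : 0 ≤ s) (k : ℝ) : 1 ≤ bracket s k :=
  Real.one_le_rpow (by nlinarith [sq_nonneg ‖k‖]) (by linarith)

@[fun_prop]
theorem continuous_bracket (s : ℝ) : Continuous (bracket s) := by
  unfold bracket
  exact Continuous.rpow_const (by fun_prop) fun k => Or.inl (by positivity)

theorem bracket_hasTemperateGrowth (s : ℝ) :
    (fun k => (bracket s k : ℂ)).HasTemperateGrowth := by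
  unfold bracket
  fun_prop

theorem smulLeftCLM_bracket_apply (s : ℝ) (φ : 𝓢(ℝ, ℂ)) (k : ℝ) :
    SchwartzMap.smulLeftCLM ℂ (fun x : ℝ => (((1 + ‖x‖ ^ 2) ^ (s / 2) : ℝ) : ℂ)) φ k =
      bracket s k * φ k :=
  SchwartzMap.smulLeftCLM_apply_apply (bracket_hasTemperateGrowth s) φ k

/-- If `|l|` is the larger of the two, then `|k + l| ≤ 2|l|`, so `1 + |k + l|² ≤ 4(1 + |l|²)`, and
`4^{s/2} = 2^s`. -/
theorem bracket_add_le {s : ℝ} (hs : 0 ≤ s) (k l : ℝ) :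
    bracket s (k + l) ≤ 2 ^ s * (bracket s k + bracket s l) := by
  have key (a b : ℝ) (hab : ‖a‖ ≤ ‖b‖) : bracket s (a + b) ≤ 2 ^ s * bracket s b := by
    have h2 : (2 : ℝ) ^ s = ((2 : ℝ) ^ 2) ^ (s / 2) := by
      rw [← Real.rpow_natCast, ← Real.rpow_mul (by norm_num)]
      congr 1
      push_cast
      ring
    rw [bracket, bracket, h2, ← Real.mul_rpow (by norm_num) (by positivity)]
    apply Real.rpow_le_rpow (by positivity) _ (by linarith)
    have := norm_add_le a b
    nlinarith [norm_nonneg (a + b), norm_nonneg a, norm_nonneg b]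
  rcases le_total ‖k‖ ‖l‖ with h | h
  · refine (key k l h).trans ?_
    gcongr
    linarith [bracket_pos s k]
  · rw [add_comm k]
    refine (key l k h).trans ?_
    gcongr
    linarith [bracket_pos s l]

theorem memLp_bracket_neg {s : ℝ} (hs : 1 / 2 < s) : MemLp (bracket (-s)) 2 volume := by
  rw [memLp_two_iff_integrable_sq (by fun_prop)]
  have h := integrable_rpow_neg_one_add_norm_sq (E := ℝ) (μ := volume) (r := 2 * s) (by
    simp; linarith)
  convert h using 2 with k
  rw [bracket, ← Real.rpow_natCast, ← Real.rpow_mul (by positivity)]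
  congr 1
  push_cast
  ring

theorem integral_fourierInv_eq {V : ℝ → ℂ} (hV : Integrable V) (φ : 𝓢(ℝ, ℂ)) :
    ∫ x, φ x * 𝓕⁻ V x = ∫ k, (𝓕⁻ φ) k * V k := by
  have hL : Continuous fun p : ℝ × ℝ => (-innerₗ ℝ : ℝ →ₗ[ℝ] ℝ →ₗ[ℝ] ℝ) p.1 p.2 := by
    simp only [LinearMap.neg_apply, innerₗ_apply_apply]
    fun_prop
  have h2 := VectorFourier.integral_fourierIntegral_smul_eq_flip (μ := volume) (ν := volume)
    (L := (-innerₗ ℝ : ℝ →ₗ[ℝ] ℝ →ₗ[ℝ] ℝ)) Real.continuous_fourierChar hL φ.integrable hV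
  have h3 : (-innerₗ ℝ : ℝ →ₗ[ℝ] ℝ →ₗ[ℝ] ℝ).flip = -innerₗ ℝ := by
    ext; simp
  rw [h3] at h2
  symm
  simpa only [SchwartzMap.fourierInv_coe] using! h2

theorem continuous_fourierInv_of_integrable {V : ℝ → ℂ} (hV : Integrable V) :
    Continuous (𝓕⁻ V) := by
  apply VectorFourier.fourierIntegral_continuous Real.continuous_fourierChar _ hV
  simp only [LinearMap.neg_apply, innerₗ_apply_apply]
  fun_prop

theorem fourierInv_mul_convolution {V W : ℝ → ℂ} (hV : Integrable V) (hW : Integrable W) (x : ℝ) :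
    𝓕⁻ (V ⋆[ContinuousLinearMap.mul ℂ ℂ] W) x = 𝓕⁻ V x * 𝓕⁻ W x := by
  simp only [Real.fourierInv_eq_fourier_neg]
  exact Real.fourier_mul_convolution_eq hV hW (-x)

namespace RealSobolev

variable {s : ℝ}

/-- An element of `H^s`, `s > 1/2`, has an integrable Fourier transform. -/
theorem exists_fourier (hs : 1 / 2 < s) (u : RealSobolev s) :
    ∃ V : ℝ → ℂ, Integrable V ∧ (∀ x, (rep hs u x : ℂ) = 𝓕⁻ V x) ∧
      AEStronglyMeasurable (fun k => (bracket s k : ℂ) * V k) ∧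
      eLpNorm (fun k => (bracket s k : ℂ) * V k) 2 volume = ‖u‖ₑ := by
  let f : Lp ℂ 2 (volume : Measure ℝ) := 𝓕 (besselL2 u)
  let V : ℝ → ℂ := fun k => (bracket (-s) k : ℂ) * f k
  have hV : Integrable V := (memLp_bracket_neg hs).ofReal.integrable_mul (Lp.memLp f)
  have hVf : (fun k => (bracket s k : ℂ) * V k) = f := by
    ext k
    simp only [V]
    rw [← mul_assoc, ← Complex.ofReal_mul, mul_comm (bracket s k), bracket_neg_mul]
    simp
  refine ⟨V, hV, ?_, ?_, ?_⟩
  · have hcont := continuous_fourierInv_of_integrable hV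
    have hae : (fun x => (rep hs u x : ℂ)) =ᵐ[volume] 𝓕⁻ V := by
      apply ae_eq_of_forall_schwartz (Continuous.locallyIntegrable (by fun_prop))
        hcont.locallyIntegrable
      intro φ
      rw [← BoundedContinuousFunction.toDist_apply, toDist_rep, integral_fourierInv_eq hV,
        toDist_eq, Lp.toTemperedDistributionCLM_apply, TemperedDistribution.besselPotential,
        TemperedDistribution.fourierMultiplierCLM_apply_apply,
        ← TemperedDistribution.fourier_apply, Lp.fourier_toTemperedDistribution_eq,
        Lp.toTemperedDistribution_apply]
      congr 1
      ext k
      rw [smulLeftCLM_bracket_apply]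
      simp only [smul_eq_mul, V, f]
      ring
    exact congrFun ((Continuous.ae_eq_iff_eq volume (by fun_prop) hcont).mp hae)
  · rw [hVf]
    exact (Lp.memLp f).1
  · rw [hVf, ← Lp.enorm_def]
    change ‖𝓕 (besselL2 u)‖ₑ = _
    rw [← ofReal_norm, ← ofReal_norm, Lp.norm_fourier_eq, norm_eq]

/-- A converse to `exists_fourier`: products are formed on the Fourier side and brought back to
`H^s` through this lemma. -/
theorem exists_of_fourier (s : ℝ) {F : ℝ →ᵇ ℝ} {V : ℝ → ℂ} (hV : Integrable V)
    (hF : ∀ x, (F x : ℂ) = 𝓕⁻ V x)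
    (hVs : MemLp (fun k => (bracket s k : ℂ) * V k) 2 volume) :
    ∃ u : RealSobolev s, toDist u = F.toDist ∧
      ‖u‖ₑ = eLpNorm (fun k => (bracket s k : ℂ) * V k) 2 volume := by
  have hf : TemperedDistribution.besselPotential ℝ ℂ s F.toDist =
      Lp.toTemperedDistributionCLM ℂ volume 2 (𝓕⁻ hVs.toLp) := by
    rw [Lp.toTemperedDistributionCLM_apply, ← Lp.fourierInv_toTemperedDistribution_eq]
    ext φ
    rw [TemperedDistribution.fourierInv_apply, Lp.toTemperedDistribution_apply,
      TemperedDistribution.besselPotential, TemperedDistribution.fourierMultiplierCLM_apply_apply,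
      BoundedContinuousFunction.toDist_apply]
    simp only [hF]
    rw [integral_fourierInv_eq hV, FourierTransform.fourierInv_fourier_eq]
    apply integral_congr_ae
    filter_upwards [hVs.coeFn_toLp] with k hk
    rw [hk, smulLeftCLM_bracket_apply, smul_eq_mul]
    ring
  let u : RealSobolev s := ofDist F.toDist ⟨_, hf⟩ F.toDist_isReal
  refine ⟨u, rfl, ?_⟩
  have hu : besselL2 u = 𝓕⁻ hVs.toLp :=
    toTemperedDistribution_injective ((besselL2_spec u).symm.trans hf)
  have : ‖𝓕⁻ hVs.toLp‖ = ‖hVs.toLp‖ := (Lp.fourierTransformₗᵢ ℝ ℂ).symm.norm_map _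
  rw [← ofReal_norm, norm_eq, hu, this, ofReal_norm, Lp.enorm_toLp]

/-- Plancherel's identity for functions with integrable Fourier transform. -/
theorem eLpNorm_rep_eq {F : ℝ →ᵇ ℝ} {V : ℝ → ℂ} (hV : Integrable V)
    (hF : ∀ x, (F x : ℂ) = 𝓕⁻ V x) (hV2 : MemLp V 2 volume) :
    eLpNorm F 2 volume = eLpNorm V 2 volume := by
  have h0 : (fun k => (bracket 0 k : ℂ) * V k) = V := by
    ext k; simp [bracket]
  obtain ⟨u, hu, hnorm⟩ := exists_of_fourier 0 hV hF (by rwa [h0])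
  rw [h0] at hnorm
  have hb := besselL2_spec u
  rw [TemperedDistribution.besselPotential_zero, ContinuousLinearMap.id_apply, hu] at hb
  have hae : (fun x => (F x : ℂ)) =ᵐ[volume] besselL2 u := by
    apply ae_eq_of_forall_schwartz (Continuous.locallyIntegrable (by fun_prop))
      ((Lp.memLp (besselL2 u)).locallyIntegrable (by norm_num))
    intro φ
    rw [← BoundedContinuousFunction.toDist_apply, hb, Lp.toTemperedDistribution_apply]
    rfl
  rw [← hnorm, ← ofReal_norm, norm_eq, ofReal_norm, Lp.enorm_def, ← eLpNorm_congr_ae hae]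
  exact eLpNorm_congr_enorm_ae (.of_forall fun x => by simp [enorm_eq_nnnorm])

end RealSobolev

/-! ### The tame product estimate. -/

/-- The `L¹` norm is controlled by interpolation between `L²` and weighted `L²` norms. -/
theorem lintegral_enorm_le_interpolation {s σ : ℝ} (hσ : 0 ≤ σ) (hσs : σ ≤ s) (hs : 0 < s)
    {V : ℝ → ℂ} (hV : AEStronglyMeasurable V) :
    ∫⁻ k, ‖V k‖ₑ ≤ eLpNorm (bracket (-σ)) 2 volume *
      (eLpNorm V 2 volume ^ (1 - σ / s) *
        eLpNorm (fun k => (bracket s k : ℂ) * V k) 2 volume ^ (σ / s)) := by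
  have hθ : 0 ≤ 1 - σ / s := sub_nonneg.mpr ((div_le_one hs).mpr hσs)
  have hθ' : 0 ≤ σ / s := by positivity
  have hVs : AEStronglyMeasurable (fun k => (bracket s k : ℂ) * V k) :=
    (Continuous.aestronglyMeasurable (by fun_prop)).mul hV
  have hVσ : AEStronglyMeasurable (fun k => (bracket σ k : ℂ) * V k) :=
    (Continuous.aestronglyMeasurable (by fun_prop)).mul hV
  have hcomm (x : ℝ≥0∞) (t : ℝ) : (x ^ 2) ^ t = (x ^ t) ^ 2 := by
    rw [← ENNReal.rpow_natCast, ← ENNReal.rpow_natCast, ← ENNReal.rpow_mul, ← ENNReal.rpow_mul,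
      mul_comm]
  rw [← ENNReal.pow_le_pow_left_iff two_ne_zero, mul_pow, mul_pow, ← hcomm, ← hcomm,
    eLpNorm_two_sq, eLpNorm_two_sq, eLpNorm_two_sq]
  -- Cauchy-Schwarz against the weight of order `-σ`, then Hölder with exponents `1 - σ/s` and
  -- `σ/s`, since the weight of order `σ` is the power `σ/s` of that of order `s`.
  calc (∫⁻ k, ‖V k‖ₑ) ^ 2
      = (∫⁻ k, ‖bracket (-σ) k‖ₑ * ‖(bracket σ k : ℂ) * V k‖ₑ) ^ 2 := by
        congr 2
        ext k
        rw [enorm_mul, ← mul_assoc]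
        have : ‖(bracket σ k : ℂ)‖ₑ = ‖bracket σ k‖ₑ := by simp [enorm_eq_nnnorm]
        rw [this, ← enorm_mul, bracket_neg_mul]
        simp
    _ ≤ (∫⁻ k, ‖bracket (-σ) k‖ₑ ^ 2) * ∫⁻ k, ‖(bracket σ k : ℂ) * V k‖ₑ ^ 2 :=
        sq_lintegral_mul_le (by fun_prop) hVσ.enorm
    _ = (∫⁻ k, ‖bracket (-σ) k‖ₑ ^ 2) * ∫⁻ k, (‖V k‖ₑ ^ 2) ^ (1 - σ / s) *
          (‖(bracket s k : ℂ) * V k‖ₑ ^ 2) ^ (σ / s) := by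
        congr 2
        ext k
        have hb : ‖(bracket σ k : ℂ)‖ₑ = ‖(bracket s k : ℂ)‖ₑ ^ (σ / s) := by
          rw [← ofReal_norm, ← ofReal_norm, Complex.norm_real, Complex.norm_real,
            ENNReal.ofReal_rpow_of_nonneg (norm_nonneg _) hθ',
            Real.norm_of_nonneg (bracket_pos _ _).le, Real.norm_of_nonneg (bracket_pos _ _).le,
            bracket, bracket, ← Real.rpow_mul (by positivity)]
          congr 2
          field_simp
        rw [hcomm, hcomm, ← mul_pow, enorm_mul, enorm_mul, ENNReal.mul_rpow_of_nonneg _ _ hθ', hb,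
          mul_left_comm, ← ENNReal.rpow_add_of_nonneg _ _ hθ hθ']
        simp
    _ ≤ _ := by
        gcongr
        exact ENNReal.lintegral_mul_norm_pow_le (hV.enorm.pow_const 2) (hVs.enorm.pow_const 2)
          hθ hθ' (by ring)

/-- By `bracket_add_le` the weight falls on one factor at a time, and Young's inequality puts the
unweighted factor in `L¹`. Only one factor of each term carries the full Sobolev norm. -/
theorem eLpNorm_bracket_mul_convolution_le {s : ℝ} (hs : 0 ≤ s) {V W : ℝ → ℂ}
    (hV : AEStronglyMeasurable V) (hW : AEStronglyMeasurable W) :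
    eLpNorm (fun k => (bracket s k : ℂ) * (V ⋆[ContinuousLinearMap.mul ℂ ℂ] W) k) 2 volume ≤
      ENNReal.ofReal (2 ^ s) *
        ((∫⁻ k, ‖V k‖ₑ) * eLpNorm (fun k => (bracket s k : ℂ) * W k) 2 volume +
          eLpNorm (fun k => (bracket s k : ℂ) * V k) 2 volume * ∫⁻ k, ‖W k‖ₑ) := by
  have hmeas {U : ℝ → ℂ} (hU : AEStronglyMeasurable U) :
      AEMeasurable (fun k => ‖(bracket s k : ℂ) * U k‖ₑ) :=
    ((Continuous.aestronglyMeasurable (f := fun k => (bracket s k : ℂ)) (by fun_prop)).mul hU).enorm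
  let v : ℝ → ℝ≥0∞ := fun k => ‖V k‖ₑ
  let w : ℝ → ℝ≥0∞ := fun k => ‖W k‖ₑ
  let vs : ℝ → ℝ≥0∞ := fun k => ‖(bracket s k : ℂ) * V k‖ₑ
  let ws : ℝ → ℝ≥0∞ := fun k => ‖(bracket s k : ℂ) * W k‖ₑ
  have hv : AEMeasurable v := hV.enorm
  have hw : AEMeasurable w := hW.enorm
  have hvs : AEMeasurable vs := hmeas hV
  have hws : AEMeasurable ws := hmeas hW
  have hpt (k : ℝ) : ‖(bracket s k : ℂ) * (V ⋆[ContinuousLinearMap.mul ℂ ℂ] W) k‖ₑ ≤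
      ENNReal.ofReal (2 ^ s) * ((v ⋆ₗ ws) k + (w ⋆ₗ vs) k) := by
    rw [lconvolution_comm (f := w), convolution_def, enorm_mul]
    simp only [ContinuousLinearMap.mul_apply']
    calc _ ≤ ‖(bracket s k : ℂ)‖ₑ * ∫⁻ t, ‖V t * W (k - t)‖ₑ := by
          gcongr
          exact enorm_integral_le_lintegral_enorm _
      _ = ∫⁻ t, ‖(bracket s k : ℂ)‖ₑ * ‖V t * W (k - t)‖ₑ := by
          rw [lintegral_const_mul' _ _ enorm_ne_top]
      _ ≤ ∫⁻ t, ENNReal.ofReal (2 ^ s) * (v t * ws (-t + k) + vs t * w (-t + k)) := by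
          apply lintegral_mono
          intro t
          have hb : ‖(bracket s k : ℂ)‖ₑ ≤
              ENNReal.ofReal (2 ^ s) * (‖(bracket s t : ℂ)‖ₑ + ‖(bracket s (-t + k) : ℂ)‖ₑ) := by
            have h0 (r : ℝ) : ‖(bracket s r : ℂ)‖ₑ = ENNReal.ofReal (bracket s r) := by
              rw [← ofReal_norm, Complex.norm_real, Real.norm_of_nonneg (bracket_pos _ _).le]
            rw [h0, h0, h0, ← ENNReal.ofReal_add (bracket_pos _ _).le (bracket_pos _ _).le,
              ← ENNReal.ofReal_mul (by positivity)]
            apply ENNReal.ofReal_le_ofReal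
            convert bracket_add_le hs t (-t + k) using 2
            ring
          simp only [v, w, vs, ws, enorm_mul, sub_eq_neg_add]
          calc _ ≤ ENNReal.ofReal (2 ^ s) *
                (‖(bracket s t : ℂ)‖ₑ + ‖(bracket s (-t + k) : ℂ)‖ₑ) *
                  (‖V t‖ₑ * ‖W (-t + k)‖ₑ) := by gcongr
            _ = _ := by ring
      _ = _ := by
          rw [lintegral_const_mul' _ _ ENNReal.ofReal_ne_top, lintegral_add_left']
          · rfl
          · exact hv.mul (hws.comp_quasiMeasurePreserving
              (by simpa only [sub_eq_neg_add] using quasiMeasurePreserving_sub_left volume k))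
  calc _ ≤ eLpNorm (fun k => ENNReal.ofReal (2 ^ s) * ((v ⋆ₗ ws) k + (w ⋆ₗ vs) k)) 2 volume :=
        eLpNorm_mono_enorm hpt
    _ ≤ ENNReal.ofReal (2 ^ s) * eLpNorm ((v ⋆ₗ ws) + (w ⋆ₗ vs)) 2 volume := by
        rw [← ENNReal.pow_le_pow_left_iff two_ne_zero, mul_pow, eLpNorm_two_sq, eLpNorm_two_sq]
        simp only [enorm_eq_self, mul_pow]
        rw [lintegral_const_mul' _ _ (by simp)]
        rfl
    _ ≤ ENNReal.ofReal (2 ^ s) * (eLpNorm (v ⋆ₗ ws) 2 volume + eLpNorm (w ⋆ₗ vs) 2 volume) := by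
        gcongr
        exact eLpNorm_add_le (aemeasurable_lconvolution hv hws).aestronglyMeasurable
          (aemeasurable_lconvolution hw hvs).aestronglyMeasurable (by norm_num)
    _ ≤ ENNReal.ofReal (2 ^ s) * ((∫⁻ k, v k) * eLpNorm ws 2 volume +
          (∫⁻ k, w k) * eLpNorm vs 2 volume) := by
        gcongr
        · exact eLpNorm_two_lconvolution_le hv hws
        · exact eLpNorm_two_lconvolution_le hw hvs
    _ = _ := by
        rw [mul_comm (∫⁻ k, w k)]
        simp only [ws, vs, eLpNorm_enorm]
        rfl

namespace RealSobolev

variable {s : ℝ}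

/-- The `L²` norm of the representative. -/
def l2norm (hs : 1 / 2 < s) (u : RealSobolev s) : ℝ := (eLpNorm (rep hs u) 2 volume).toReal

theorem l2norm_nonneg (hs : 1 / 2 < s) (u : RealSobolev s) : 0 ≤ l2norm hs u :=
  ENNReal.toReal_nonneg

theorem eLpNorm_le_eLpNorm_bracket_mul (hs : 1 / 2 < s) (V : ℝ → ℂ) :
    eLpNorm V 2 volume ≤ eLpNorm (fun k => (bracket s k : ℂ) * V k) 2 volume := by
  apply eLpNorm_mono_enorm
  intro k
  rw [enorm_mul, ← ofReal_norm (bracket s k : ℂ), Complex.norm_real,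
    Real.norm_of_nonneg (bracket_pos _ _).le]
  apply le_mul_of_one_le_left zero_le
  exact ENNReal.one_le_ofReal.mpr (one_le_bracket (by linarith) k)

theorem eLpNorm_rep_le (hs : 1 / 2 < s) (u : RealSobolev s) :
    eLpNorm (rep hs u) 2 volume ≤ ‖u‖ₑ := by
  obtain ⟨V, hV, hF, hm, hn⟩ := exists_fourier hs u
  have h := eLpNorm_le_eLpNorm_bracket_mul hs V
  rw [hn] at h
  rwa [eLpNorm_rep_eq hV hF ⟨hV.1, h.trans_lt enorm_lt_top⟩]

theorem memLp_rep (hs : 1 / 2 < s) (u : RealSobolev s) : MemLp (rep hs u) 2 volume :=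
  ⟨(rep hs u).continuous.aestronglyMeasurable, (eLpNorm_rep_le hs u).trans_lt enorm_lt_top⟩

theorem l2norm_le (hs : 1 / 2 < s) (u : RealSobolev s) : l2norm hs u ≤ ‖u‖ := by
  have := ENNReal.toReal_mono enorm_ne_top (eLpNorm_rep_le hs u)
  rwa [toReal_enorm] at this

/-- `H^s` is an algebra for `s > 1/2`, with a bound on products that is better than bilinear. -/
theorem exists_mul (hs : 1 / 2 < s) : ∃ K θ : ℝ, 0 < K ∧ 0 < θ ∧ θ < 1 ∧
    ∀ u v : RealSobolev s, ∃ w : RealSobolev s, toDist w = (rep hs u * rep hs v).toDist ∧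
      ‖w‖ ≤ K * (l2norm hs u ^ θ * ‖u‖ ^ (1 - θ) * ‖v‖ +
        ‖u‖ * (l2norm hs v ^ θ * ‖v‖ ^ (1 - θ))) := by
  -- `σ > 1/2` makes the weight of order `-σ` square-integrable; `σ < s` makes the exponent `θ = 1 -
  -- σ/s` of the `L²` norm positive.
  obtain ⟨σ, hσ, hσs⟩ := exists_between hs
  have hs0 : 0 < s := by linarith
  have hC := (memLp_bracket_neg hσ).2.ne
  set C := eLpNorm (bracket (-σ)) 2 volume with hCdef
  have hθ : 0 < σ / s := by apply div_pos <;> linarith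
  have hθ1 : σ / s < 1 := (div_lt_one hs0).mpr hσs
  refine ⟨2 ^ s * (C.toReal + 1), 1 - σ / s, by positivity, by linarith, by linarith, ?_⟩
  intro u v
  obtain ⟨V, hV, hVF, hVm, hVn⟩ := exists_fourier hs u
  obtain ⟨W, hW, hWF, hWm, hWn⟩ := exists_fourier hs v
  have hVW : Integrable (V ⋆[ContinuousLinearMap.mul ℂ ℂ] W) :=
    hV.integrable_convolution _ hW
  have hl2 {u : RealSobolev s} {V : ℝ → ℂ} (hV : Integrable V)
      (hVF : ∀ x, (rep hs u x : ℂ) = 𝓕⁻ V x)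
      (hVn : eLpNorm (fun k => (bracket s k : ℂ) * V k) 2 volume = ‖u‖ₑ) :
      ∫⁻ k, ‖V k‖ₑ ≤ ENNReal.ofReal
        ((C.toReal + 1) * (l2norm hs u ^ (1 - σ / s) * ‖u‖ ^ (1 - (1 - σ / s)))) := by
    have h := lintegral_enorm_le_interpolation (by linarith) hσs.le hs0 hV.1
    have h2 := eLpNorm_le_eLpNorm_bracket_mul hs V
    rw [hVn] at h2
    rw [hVn, ← eLpNorm_rep_eq hV hVF ⟨hV.1, h2.trans_lt enorm_lt_top⟩] at h
    rw [← hCdef, ← ENNReal.ofReal_toReal (memLp_rep hs u).2.ne, ← ENNReal.ofReal_toReal hC,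
      ← ofReal_norm,
      ENNReal.ofReal_rpow_of_nonneg ENNReal.toReal_nonneg (by linarith),
      ENNReal.ofReal_rpow_of_nonneg (norm_nonneg _) hθ.le,
      ← ENNReal.ofReal_mul (by positivity), ← ENNReal.ofReal_mul (by positivity)] at h
    refine h.trans (ENNReal.ofReal_le_ofReal ?_)
    rw [sub_sub_cancel]
    gcongr
    · linarith
    · exact le_rfl
  have hb := eLpNorm_bracket_mul_convolution_le hs0.le hV.1 hW.1
  rw [hVn, hWn] at hb
  set a := l2norm hs u ^ (1 - σ / s) * ‖u‖ ^ (1 - (1 - σ / s)) with ha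
  set b := l2norm hs v ^ (1 - σ / s) * ‖v‖ ^ (1 - (1 - σ / s)) with hbb
  have ha0 : 0 ≤ a := mul_nonneg (Real.rpow_nonneg (l2norm_nonneg _ _) _) (by positivity)
  have hb0 : 0 ≤ b := mul_nonneg (Real.rpow_nonneg (l2norm_nonneg _ _) _) (by positivity)
  have hb' : eLpNorm (fun k => (bracket s k : ℂ) * (V ⋆[ContinuousLinearMap.mul ℂ ℂ] W) k) 2 volume
      ≤ ENNReal.ofReal (2 ^ s * (C.toReal + 1) * (a * ‖v‖ + ‖u‖ * b)) := by
    refine hb.trans ?_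
    calc _ ≤ ENNReal.ofReal (2 ^ s) * (ENNReal.ofReal ((C.toReal + 1) * a) * ‖v‖ₑ +
          ‖u‖ₑ * ENNReal.ofReal ((C.toReal + 1) * b)) := by
          gcongr
          · exact hl2 hV hVF hVn
          · exact hl2 hW hWF hWn
      _ = _ := by
          rw [← ofReal_norm, ← ofReal_norm, ← ENNReal.ofReal_mul (by positivity),
            ← ENNReal.ofReal_mul (by positivity), ← ENNReal.ofReal_add (by positivity)
              (by positivity), ← ENNReal.ofReal_mul (by positivity)]
          congr 1
          ring
  obtain ⟨w, hw, hwn⟩ := exists_of_fourier s (F := rep hs u * rep hs v) hVW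
    (fun x => by
      rw [fourierInv_mul_convolution hV hW, ← hVF, ← hWF]
      simp)
    ⟨(Continuous.aestronglyMeasurable (by fun_prop)).mul hVW.1,
      hb'.trans_lt ENNReal.ofReal_lt_top⟩
  refine ⟨w, hw, ?_⟩
  rw [← hwn, ← ofReal_norm] at hb'
  exact (ENNReal.ofReal_le_ofReal_iff (by positivity)).mp hb'

end RealSobolev

/-! ### The recursion for repeated squaring. -/

open Filter Topology

/-- A quadratic-type recursion is beaten by doubly exponential decay when the growth exponent is
less than two. -/
theorem tendsto_zero_of_recursion_aux {x y : ℕ → ℝ} {Q K θ : ℝ} (hQ : 0 < Q) (hQ1 : Q < 1)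
    (hK : 0 ≤ K) (hθ : 0 < θ) (hθ1 : θ < 1) (hx : ∀ i, 0 ≤ x i) (hy : ∀ i, 0 ≤ y i)
    (hyr : ∀ i, y (i + 1) ≤ Q ^ 2 ^ i * y i)
    (hxr : ∀ i, x (i + 1) ≤ Q ^ 2 ^ i * x i + K * y i ^ θ * x i ^ (2 - θ)) :
    Tendsto x atTop (𝓝 0) := by
  -- The first `i` factors multiply to `Q^(2^i - 1)`, hence the division by `Q`.
  set Y := y 0 / Q with hY
  have hY0 : 0 ≤ Y := div_nonneg (hy 0) hQ.le
  have hyb (i : ℕ) : y i ≤ Y * Q ^ 2 ^ i := by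
    induction i with
    | zero => simp [hY, hQ.ne']
    | succ i ih =>
      calc _ ≤ Q ^ 2 ^ i * y i := hyr i
        _ ≤ Q ^ 2 ^ i * (Y * Q ^ 2 ^ i) := by gcongr
        _ = _ := by rw [pow_succ 2, pow_mul]; ring
  -- Since `θ + (2 - θ) = 2`, dividing by `Q^(2^i)` removes every power of `Q` from the recursion;
  -- `w` then grows at most like `E^(β^i)` with `β = 2 - θ < 2`.
  set w : ℕ → ℝ := fun i => x i / Q ^ 2 ^ i with hw
  have hw0 (i : ℕ) : 0 ≤ w i := div_nonneg (hx i) (by positivity)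
  have hxw (i : ℕ) : x i = w i * Q ^ 2 ^ i := by
    rw [hw]; field_simp
  set β := 2 - θ with hβ
  have hβ1 : 1 < β := by linarith
  set L := 1 + K * Y ^ θ with hL
  have hL1 : 1 ≤ L := by
    have : 0 ≤ K * Y ^ θ := by positivity
    linarith
  have hwr (i : ℕ) : max 1 (w (i + 1)) ≤ L * max 1 (w i) ^ β := by
    have hm : 1 ≤ max 1 (w i) := le_max_left _ _
    have hm1 : max 1 (w i) ≤ max 1 (w i) ^ β := Real.self_le_rpow_of_one_le hm hβ1.le
    apply max_le
    · exact one_le_mul_of_one_le_of_one_le hL1 (hm.trans hm1)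
    · have hq : (0 : ℝ) < Q ^ 2 ^ i := by positivity
      have h1 : x (i + 1) ≤ (w i + K * Y ^ θ * w i ^ β) * Q ^ 2 ^ (i + 1) := by
        calc _ ≤ Q ^ 2 ^ i * x i + K * y i ^ θ * x i ^ β := hxr i
          _ ≤ Q ^ 2 ^ i * x i + K * (Y * Q ^ 2 ^ i) ^ θ * x i ^ β := by
            gcongr
            · exact Real.rpow_nonneg (hx i) _
            · exact hy i
            · exact hyb i
          _ = Q ^ 2 ^ i * (w i * Q ^ 2 ^ i) +
                K * (Y ^ θ * (Q ^ 2 ^ i) ^ θ) * (w i ^ β * (Q ^ 2 ^ i) ^ β) := by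
            rw [← Real.mul_rpow hY0 hq.le, ← Real.mul_rpow (hw0 i) hq.le, ← hxw]
          _ = w i * (Q ^ 2 ^ i) ^ 2 +
                K * Y ^ θ * w i ^ β * ((Q ^ 2 ^ i) ^ θ * (Q ^ 2 ^ i) ^ β) := by ring
          _ = _ := by
            rw [← Real.rpow_add hq, hβ, add_sub_cancel, Real.rpow_two, pow_succ 2 i, pow_mul]
            ring
      calc w (i + 1) = x (i + 1) / Q ^ 2 ^ (i + 1) := rfl
        _ ≤ w i + K * Y ^ θ * w i ^ β := (div_le_iff₀ (by positivity)).mpr h1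
        _ ≤ max 1 (w i) ^ β + K * Y ^ θ * max 1 (w i) ^ β := by
          gcongr
          · exact (le_max_right 1 (w i)).trans hm1
          · exact hw0 i
          · exact le_max_right _ _
        _ = _ := by ring
  -- The exponent with `c + 1 = c β`: multiplying by `L^c` turns `m ↦ L m^β` into the pure power `m
  -- ↦ m^β`.
  set c := 1 / (β - 1) with hc
  have hcβ : c + 1 = c * β := by
    rw [hc]
    have : β - 1 ≠ 0 := by linarith
    field_simp
    ring
  set E := L ^ c * max 1 (w 0) with hE
  have hLc : 1 ≤ L ^ c := Real.one_le_rpow hL1 (by rw [hc]; apply div_nonneg <;> linarith)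
  have hE1 : 1 ≤ E := one_le_mul_of_one_le_of_one_le hLc (le_max_left _ _)
  have hm0 (i : ℕ) : 0 ≤ max 1 (w i) := zero_le_one.trans (le_max_left _ _)
  have hLi (i : ℕ) : L ^ c * max 1 (w i) ≤ E ^ (β ^ i) := by
    induction i with
    | zero => simp [hE]
    | succ i ih =>
      calc _ ≤ L ^ c * (L * max 1 (w i) ^ β) := by gcongr; exact hwr i
        _ = (L ^ c * max 1 (w i)) ^ β := by
          rw [Real.mul_rpow (by positivity) (hm0 i), ← Real.rpow_mul (by linarith), ← hcβ,
            Real.rpow_add_one (by linarith)]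
          ring
        _ ≤ (E ^ (β ^ i)) ^ β :=
          Real.rpow_le_rpow (mul_nonneg (by positivity) (hm0 i)) ih (by linarith)
        _ = _ := by rw [← Real.rpow_mul (by linarith), pow_succ]
  have hwE (i : ℕ) : w i ≤ E ^ (β ^ i) :=
    (le_max_right 1 (w i)).trans ((le_mul_of_one_le_left (hm0 i) hLc).trans (hLi i))
  have hxE (i : ℕ) : x i ≤ Real.exp (2 ^ i * (Real.log Q + (β / 2) ^ i * Real.log E)) := by
    have h2 : (2 : ℝ) ^ i * (Real.log Q + (β / 2) ^ i * Real.log E) =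
        Real.log E * β ^ i + (2 ^ i : ℕ) * Real.log Q := by
      push_cast
      rw [div_pow]
      field_simp
      ring
    rw [h2, Real.exp_add, ← Real.rpow_def_of_pos (by linarith), ← Real.log_pow,
      Real.exp_log (by positivity), hxw]
    gcongr
    exact hwE i
  refine squeeze_zero hx hxE (Real.tendsto_exp_atBot.comp ?_)
  have hlim : Tendsto (fun i : ℕ => Real.log Q + (β / 2) ^ i * Real.log E) atTop
      (𝓝 (Real.log Q + 0 * Real.log E)) :=
    ((tendsto_pow_atTop_nhds_zero_of_lt_one (by linarith) (by linarith)).mul_const _).const_add _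
  refine (tendsto_pow_atTop_atTop_of_one_lt (by norm_num : (1 : ℝ) < 2)).atTop_mul_neg ?_ hlim
  simpa using Real.log_neg hQ hQ1

/-- The factor 2 is harmless: starting at an index `J` with `2 q^(2^J) < 1`, it is absorbed into the
new base `Q = 2 q^(2^J)`. -/
theorem tendsto_zero_of_recursion {x y : ℕ → ℝ} {q K θ : ℝ} (hq : 0 < q) (hq1 : q < 1)
    (hK : 0 ≤ K) (hθ : 0 < θ) (hθ1 : θ < 1) (hx : ∀ i, 0 ≤ x i) (hy : ∀ i, 0 ≤ y i)
    (hyr : ∀ i, y (i + 1) ≤ 2 * q ^ 2 ^ i * y i)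
    (hxr : ∀ i, x (i + 1) ≤ 2 * q ^ 2 ^ i * x i + K * y i ^ θ * x i ^ (2 - θ)) :
    Tendsto x atTop (𝓝 0) := by
  have hlim : Tendsto (fun J : ℕ => 2 * q ^ 2 ^ J) atTop (𝓝 (2 * 0)) :=
    ((tendsto_pow_atTop_nhds_zero_of_lt_one hq.le hq1).comp
      (tendsto_pow_atTop_atTop_of_one_lt (by norm_num))).const_mul 2
  obtain ⟨J, hJ⟩ := (hlim.eventually (gt_mem_nhds (by norm_num : (2 : ℝ) * 0 < 1))).exists
  have hpow (i : ℕ) : 2 * q ^ 2 ^ (i + J) ≤ (2 * q ^ 2 ^ J) ^ 2 ^ i := by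
    rw [mul_pow, ← pow_mul, ← pow_add, add_comm J]
    gcongr
    exact le_self_pow₀ (by norm_num) (by positivity)
  rw [← tendsto_add_atTop_iff_nat J]
  refine tendsto_zero_of_recursion_aux (Q := 2 * q ^ 2 ^ J) (y := fun i => y (i + J))
    (by positivity) hJ hK hθ hθ1 (fun i => hx _) (fun i => hy _) (fun i => ?_) (fun i => ?_)
  · rw [add_right_comm]
    exact (hyr _).trans (by gcongr; exacts [hy _, hpow i])
  · rw [add_right_comm]
    exact (hxr _).trans (by gcongr; exacts [hx _, hpow i])

/-! ### Multiplication operators on `H^s` and division by `h`. -/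

namespace RealSobolev

variable {s : ℝ}

theorem rep_injective (hs : 1 / 2 < s) : Function.Injective (rep hs) := fun u v h =>
  toDist_injective (by rw [← toDist_rep hs u, h, toDist_rep])

theorem rep_add (hs : 1 / 2 < s) (u v : RealSobolev s) : rep hs (u + v) = rep hs u + rep hs v :=
  map_add (repL hs) u v

theorem rep_smul (hs : 1 / 2 < s) (c : ℝ) (u : RealSobolev s) : rep hs (c • u) = c • rep hs u :=
  map_smul (repL hs) c u

/-- The product of two elements of `H^s`, `s > 1/2`. -/
def mul (hs : 1 / 2 < s) (u v : RealSobolev s) : RealSobolev s :=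
  ((exists_mul hs).choose_spec.choose_spec.2.2.2 u v).choose

theorem rep_mul (hs : 1 / 2 < s) (u v : RealSobolev s) :
    rep hs (mul hs u v) = rep hs u * rep hs v :=
  rep_eq_of_toDist_eq hs
    ((exists_mul hs).choose_spec.choose_spec.2.2.2 u v).choose_spec.1.symm

theorem exists_norm_mul_le (hs : 1 / 2 < s) : ∃ K θ : ℝ, 0 < K ∧ 0 < θ ∧ θ < 1 ∧
    ∀ u v : RealSobolev s, ‖mul hs u v‖ ≤
      K * (l2norm hs u ^ θ * ‖u‖ ^ (1 - θ) * ‖v‖ + ‖u‖ * (l2norm hs v ^ θ * ‖v‖ ^ (1 - θ))) := by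
  have h := (exists_mul hs).choose_spec.choose_spec
  exact ⟨_, _, h.1, h.2.1, h.2.2.1, fun u v => (h.2.2.2 u v).choose_spec.2⟩

theorem exists_norm_mul_le_mul_norm (hs : 1 / 2 < s) : ∃ K : ℝ, 0 < K ∧
    ∀ u v : RealSobolev s, ‖mul hs u v‖ ≤ K * ‖u‖ * ‖v‖ := by
  obtain ⟨K, θ, hK, hθ, hθ1, h⟩ := exists_norm_mul_le hs
  refine ⟨2 * K, by positivity, fun u v => (h u v).trans ?_⟩
  have key (u : RealSobolev s) : l2norm hs u ^ θ * ‖u‖ ^ (1 - θ) ≤ ‖u‖ := by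
    calc _ ≤ ‖u‖ ^ θ * ‖u‖ ^ (1 - θ) := by
          gcongr
          exacts [l2norm_nonneg hs u, l2norm_le hs u]
      _ = ‖u‖ := by
          rw [← Real.rpow_add_of_nonneg (norm_nonneg _) hθ.le (by linarith)]
          simp
  calc _ ≤ K * (‖u‖ * ‖v‖ + ‖u‖ * ‖v‖) := by gcongr <;> exact key _
    _ = _ := by ring

/-- Multiplication by an element of `H^s` as an operator on `H^s`. -/
def mulL (hs : 1 / 2 < s) (u : RealSobolev s) : RealSobolev s →L[ℝ] RealSobolev s :=
  LinearMap.mkContinuousOfExistsBound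
    { toFun := mul hs u
      map_add' := fun v w => rep_injective hs (by
        simp only [rep_mul, rep_add, mul_add])
      map_smul' := fun c v => rep_injective hs (by
        simp only [rep_mul, rep_smul, RingHom.id_apply, mul_smul_comm]) }
    ⟨_, fun v => (exists_norm_mul_le_mul_norm hs).choose_spec.2 u v⟩

theorem rep_smul_add_mulL_pow (hs : 1 / 2 < s) (a : ℝ) (f u : RealSobolev s) (n : ℕ) (x : ℝ) :
    rep hs (((a • 1 + mulL hs f) ^ n : RealSobolev s →L[ℝ] RealSobolev s) u) x =
      (a + rep hs f x) ^ n * rep hs u x := by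
  induction n with
  | zero => simp
  | succ n ih =>
    rw [pow_succ']
    change rep hs (a • (((a • 1 + mulL hs f) ^ n : RealSobolev s →L[ℝ] RealSobolev s) u) +
      mul hs f (((a • 1 + mulL hs f) ^ n : RealSobolev s →L[ℝ] RealSobolev s) u)) x = _
    rw [rep_add, rep_smul, rep_mul]
    simp only [BoundedContinuousFunction.coe_add, BoundedContinuousFunction.coe_smul,
      BoundedContinuousFunction.coe_mul, Pi.add_apply, Pi.mul_apply, ih, smul_eq_mul]
    ring

/-- If `|a|` and `|a + f|` stay below one, then `1 - (a + f)` is invertible as a multiplication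
operator on `H^s`. -/
theorem isUnit_one_sub (hs : 1 / 2 < s) {a q : ℝ} {f : RealSobolev s} (hq : 0 < q) (hq1 : q < 1)
    (ha : |a| ≤ q) (hf : ∀ x, |a + rep hs f x| ≤ q) :
    IsUnit (1 - (a • 1 + mulL hs f) : RealSobolev s →L[ℝ] RealSobolev s) := by
  obtain ⟨K, θ, hK, hθ, hθ1, hmul⟩ := exists_norm_mul_le hs
  obtain ⟨K', hK', hmul'⟩ := exists_norm_mul_le_mul_norm hs
  -- `F j` is the `H^s` part of `(a + f)^(2^j) = a^(2^j) + F j`; constants are not in `H^s` and are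
  -- tracked separately.
  let F : ℕ → RealSobolev s := fun j =>
    Nat.rec f (fun j g => (2 * a ^ 2 ^ j) • g + mul hs g g) j
  have hF (j : ℕ) : F (j + 1) = (2 * a ^ 2 ^ j) • F j + mul hs (F j) (F j) := rfl
  have hFx (j : ℕ) (x : ℝ) : a ^ 2 ^ j + rep hs (F j) x = (a + rep hs f x) ^ 2 ^ j := by
    induction j with
    | zero => simp [F]
    | succ j ih =>
      rw [hF, rep_add, rep_smul, rep_mul, pow_succ 2, pow_mul _ (2 ^ j) 2,
        pow_mul _ (2 ^ j) 2, ← ih]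
      simp only [BoundedContinuousFunction.coe_add, BoundedContinuousFunction.coe_smul,
        BoundedContinuousFunction.coe_mul, Pi.add_apply, Pi.mul_apply, smul_eq_mul]
      ring
  have haj (j : ℕ) : |a ^ 2 ^ j| ≤ q ^ 2 ^ j := by
    rw [abs_pow]; gcongr
  have hop (j : ℕ) : (a • 1 + mulL hs f) ^ 2 ^ j = (a ^ 2 ^ j) • 1 + mulL hs (F j) := by
    ext u
    apply rep_injective hs
    ext x
    rw [rep_smul_add_mulL_pow, ← hFx]
    change _ = rep hs (a ^ 2 ^ j • u + mul hs (F j) u) x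
    rw [rep_add, rep_smul, rep_mul]
    simp only [BoundedContinuousFunction.coe_add, BoundedContinuousFunction.coe_smul,
        BoundedContinuousFunction.coe_mul, Pi.add_apply, Pi.mul_apply, smul_eq_mul]
    ring
  have hlim : Tendsto (fun j => ‖F j‖) atTop (𝓝 0) := by
    refine tendsto_zero_of_recursion (y := fun j => l2norm hs (F j)) (K := 2 * K) (θ := θ) hq hq1
      (by positivity) hθ hθ1 (fun j => norm_nonneg _) (fun j => l2norm_nonneg hs _) (fun j => ?_)
      (fun j => ?_)
    -- `F (j+1) = (a^(2^j) + (a + f)^(2^j)) F j`, and the first factor is at most `2 q^(2^j)` in the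
    -- sup norm.
    · have h1 : eLpNorm (rep hs (F (j + 1))) 2 volume ≤
          ENNReal.ofReal (2 * q ^ 2 ^ j) * eLpNorm (rep hs (F j)) 2 volume := by
        apply eLpNorm_le_mul_eLpNorm_of_ae_le_mul
        refine .of_forall fun x => ?_
        have : rep hs (F (j + 1)) x =
            (a ^ 2 ^ j + (a ^ 2 ^ j + rep hs (F j) x)) * rep hs (F j) x := by
          rw [hF, rep_add, rep_smul, rep_mul]
          simp only [BoundedContinuousFunction.coe_add, BoundedContinuousFunction.coe_smul,
            BoundedContinuousFunction.coe_mul, Pi.add_apply, Pi.mul_apply, smul_eq_mul]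
          ring
        rw [this, norm_mul]
        gcongr
        have h2 : |(a + rep hs f x) ^ 2 ^ j| ≤ q ^ 2 ^ j := by
          rw [abs_pow]
          gcongr
          exact hf x
        rw [hFx, two_mul]
        exact (abs_add_le _ _).trans (add_le_add (haj j) h2)
      have h3 := ENNReal.toReal_mono
        (ENNReal.mul_ne_top ENNReal.ofReal_ne_top (memLp_rep hs (F j)).2.ne) h1
      rwa [ENNReal.toReal_mul, ENNReal.toReal_ofReal (by positivity)] at h3
    · rw [hF]
      refine (norm_add_le _ _).trans (add_le_add ?_ ((hmul _ _).trans (le_of_eq ?_)))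
      · rw [norm_smul, norm_mul]
        gcongr
        · simp
        · exact haj j
      · have : ‖F j‖ ^ (2 - θ) = ‖F j‖ ^ (1 - θ) * ‖F j‖ := by
          rw [← Real.rpow_add_one' (norm_nonneg _) (by linarith)]
          congr 1
          ring
        rw [this]
        ring
  have hlim2 : Tendsto (fun j : ℕ => q ^ 2 ^ j + K' * ‖F j‖) atTop (𝓝 (0 + K' * 0)) :=
    ((tendsto_pow_atTop_nhds_zero_of_lt_one hq.le hq1).comp
      (tendsto_pow_atTop_atTop_of_one_lt (by norm_num))).add (hlim.const_mul K')
  obtain ⟨j, hj⟩ := (hlim2.eventually (gt_mem_nhds (by norm_num : (0 : ℝ) + K' * 0 < 1))).exists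
  have hnorm : ‖(a • 1 + mulL hs f) ^ 2 ^ j‖ < 1 := by
    rw [hop]
    refine lt_of_le_of_lt (ContinuousLinearMap.opNorm_le_bound _ (by positivity) fun u => ?_) hj
    change ‖a ^ 2 ^ j • u + mul hs (F j) u‖ ≤ _
    refine (norm_add_le _ _).trans ?_
    rw [add_mul, norm_smul]
    gcongr
    · exact haj j
    · exact hmul' _ _
  have hunit := isUnit_one_sub_of_norm_lt_one hnorm
  -- `1 - T` is a factor of the unit `1 - T^(2^j)`, and commuting factors of a unit are units.
  have hcomm : Commute (1 : RealSobolev s →L[ℝ] RealSobolev s) (a • 1 + mulL hs f) :=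
    Commute.one_left _
  have hdvd := hcomm.mul_geom_sum₂ (2 ^ j)
  rw [one_pow] at hdvd
  rw [← hdvd] at hunit
  refine ((Commute.isUnit_mul_iff ?_).mp hunit).1
  refine Commute.sum_right _ _ _ fun i _ => ?_
  apply Commute.mul_right
  · simp
  · exact ((Commute.one_left _).sub_left (Commute.refl _)).pow_right _

/-- Division by a function in `1 + H^s` that is bounded below preserves `H^s`. -/
theorem exists_div (hs : 1 / 2 < s) {h : ℝ →ᵇ ℝ} {η : RealSobolev s} (hη : h = 1 + rep hs η)
    {m : ℝ} (hm : 0 < m) (hmh : ∀ x, m ≤ h x) (G : RealSobolev s) :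
    ∃ v : RealSobolev s, h * rep hs v = rep hs G := by
  set M := 1 + ‖h‖ with hM
  have hM1 : 1 ≤ M := by rw [hM]; linarith [norm_nonneg h]
  have hM0 : 0 < M := by linarith
  have hhM (x : ℝ) : h x ≤ M := by
    have := (le_abs_self _).trans (h.norm_coe_le_norm x)
    linarith
  have hgx (x : ℝ) : (1 - 1 / M) + rep hs (-(1 / M) • η) x = 1 - h x / M := by
    rw [rep_smul, hη]
    simp
    ring
  -- The entry `1/2` only ensures `q > 0`.
  set q := max (1 / 2) (max (1 - 1 / M) (1 - m / M)) with hq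
  have hunit : IsUnit (1 - ((1 - 1 / M) • 1 + mulL hs (-(1 / M) • η)) :
      RealSobolev s →L[ℝ] RealSobolev s) := by
    apply isUnit_one_sub hs (q := q)
    · exact lt_max_of_lt_left (by norm_num)
    · apply max_lt (by norm_num) (max_lt _ _)
      · have : 0 < 1 / M := by positivity
        linarith
      · have : 0 < m / M := by positivity
        linarith
    · rw [abs_of_nonneg]
      · exact (le_max_left _ _).trans (le_max_right _ _)
      · rw [sub_nonneg, div_le_one hM0]; exact hM1
    · intro x
      rw [hgx, abs_of_nonneg]
      · refine le_trans ?_ ((le_max_right _ _).trans (le_max_right _ _))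
        gcongr
        exact hmh x
      · rw [sub_nonneg, div_le_one hM0]; exact hhM x
  obtain ⟨T, hT⟩ := hunit
  refine ⟨(↑T⁻¹ : RealSobolev s →L[ℝ] RealSobolev s) ((1 / M) • G), ?_⟩
  set v := (↑T⁻¹ : RealSobolev s →L[ℝ] RealSobolev s) ((1 / M) • G) with hv
  have hTv : (T : RealSobolev s →L[ℝ] RealSobolev s) v = (1 / M) • G := by
    rw [hv, ← mul_apply_eq_comp, Units.mul_inv, one_apply_eq_self]
  have hv2 : v = (1 / M) • G + ((1 - 1 / M) • v + mul hs (-(1 / M) • η) v) := by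
    rw [← hTv, hT]
    change v = v - ((1 - 1 / M) • v + mul hs (-(1 / M) • η) v) + _
    abel
  ext x
  have hvx := congrArg (fun w => rep hs w x) hv2
  simp only [rep_add, rep_mul, rep_smul _ (1 / M), rep_smul _ (1 - 1 / M),
    BoundedContinuousFunction.coe_add, BoundedContinuousFunction.coe_smul,
    BoundedContinuousFunction.coe_mul, Pi.add_apply, Pi.mul_apply, smul_eq_mul] at hvx
  rw [← add_mul, hgx] at hvx
  rw [BoundedContinuousFunction.coe_mul, Pi.mul_apply]
  field_simp at hvx
  linarith

end RealSobolev

/-! ### Weak derivatives in `L²` and integration by parts. -/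

/-- Pointwise multiplication by a bounded continuous function on `L²`. -/
def mulLp (a : ℝ →ᵇ ℝ) : Lp ℝ 2 (volume : Measure ℝ) →L[ℝ] Lp ℝ 2 (volume : Measure ℝ) :=
  (ContinuousLinearMap.mul ℝ ℝ).holderL volume ∞ 2 2 (a.memLp_top.toLp a)

theorem coeFn_mulLp (a : ℝ →ᵇ ℝ) (u : Lp ℝ 2 (volume : Measure ℝ)) :
    mulLp a u =ᵐ[volume] fun x => a x * u x := by
  have h := (ContinuousLinearMap.mul ℝ ℝ).coeFn_holder (r := 2) (a.memLp_top.toLp a) u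
  filter_upwards [h, a.memLp_top.coeFn_toLp (μ := volume)] with x hx hx2
  rw [hx2] at hx
  exact hx

theorem realL2Dist_toLp (φ : 𝓢(ℝ, ℝ)) :
    realL2Dist (φ.toLp 2) =
      SchwartzMap.toTemperedDistributionCLM ℝ ℂ volume (schwartzOfReal φ) := by
  ext ψ
  refine Eq.trans ?_
    (SchwartzMap.toTemperedDistributionCLM_apply_apply volume (schwartzOfReal φ) ψ).symm
  rw [realL2Dist_apply]
  apply integral_congr_ae
  filter_upwards [φ.coeFn_toLp 2 volume] with x hx
  simp [hx]

theorem realL2Dist_apply_schwartzOfReal (g : Lp ℝ 2 (volume : Measure ℝ)) (φ : 𝓢(ℝ, ℝ)) :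
    realL2Dist g (schwartzOfReal φ) = (inner ℝ g (φ.toLp 2) : ℝ) := by
  rw [realL2Dist_apply, L2.inner_def, ← integral_complex_ofReal]
  apply integral_congr_ae
  filter_upwards [φ.coeFn_toLp 2 volume] with x hx
  simp [hx]

/-- Pairs of square-integrable functions, as a Hilbert space. -/
abbrev L2Pair : Type := WithLp 2 (Lp ℝ 2 (volume : Measure ℝ) × Lp ℝ 2 (volume : Measure ℝ))

/-- The map `(u, p) ↦ u_x - p` on pairs of square-integrable functions. -/
def weakDerivDefect :
    L2Pair →L[ℝ] 𝓢'(ℝ, ℂ) :=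
  ((LineDeriv.lineDerivOpCLM ℂ 𝓢'(ℝ, ℂ) (1 : ℝ)).restrictScalars ℝ ∘L realL2Dist ∘L
    WithLp.fstL 2 ℝ _ _) - realL2Dist ∘L WithLp.sndL 2 ℝ _ _

/-- The graph of the weak derivative on `L²`: a copy of `H¹` as a Hilbert space. -/
def weakDerivGraph :
    Submodule ℝ (L2Pair) :=
  weakDerivDefect.ker

theorem mem_weakDerivGraph
    {z : L2Pair} :
    z ∈ weakDerivGraph ↔ ∂_{(1 : ℝ)} (realL2Dist z.fst) = realL2Dist z.snd := by
  rw [weakDerivGraph, LinearMap.mem_ker]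
  exact sub_eq_zero

instance : CompleteSpace weakDerivGraph :=
  weakDerivDefect.isClosed_ker.completeSpace_coe

theorem toLp_mem_weakDerivGraph (φ : 𝓢(ℝ, ℝ)) :
    WithLp.toLp 2 (φ.toLp 2 volume, (∂_{(1 : ℝ)} φ).toLp 2 volume) ∈ weakDerivGraph := by
  rw [mem_weakDerivGraph]
  simp only [WithLp.toLp_fst, WithLp.toLp_snd]
  rw [realL2Dist_toLp, realL2Dist_toLp, ← deriv_schwartzOfReal,
    TemperedDistribution.lineDerivOp_toTemperedDistributionCLM_eq]

theorem inner_compLp_ofReal (f g : Lp ℝ 2 (volume : Measure ℝ)) :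
    inner ℂ (Complex.ofRealCLM.compLp f) (Complex.ofRealCLM.compLp g) = (inner ℝ f g : ℝ) := by
  rw [L2.inner_def, L2.inner_def, ← integral_complex_ofReal]
  apply integral_congr_ae
  filter_upwards [Complex.ofRealCLM.coeFn_compLp f, Complex.ofRealCLM.coeFn_compLp g] with x hf hg
  simp [hf, hg]

/-- The symbol identity holds in `𝓢'`; local integrability of both sides makes it hold almost
everywhere. It allows integration by parts through Plancherel, with no density argument. -/
theorem fourier_compLp_ae_eq {u p : Lp ℝ 2 (volume : Measure ℝ)}
    (h : ∂_{(1 : ℝ)} (realL2Dist u) = realL2Dist p) :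
    (𝓕 (Complex.ofRealCLM.compLp p) : Lp ℂ 2 (volume : Measure ℝ)) =ᵐ[volume] fun k =>
      2 * Real.pi * Complex.I * k *
        (𝓕 (Complex.ofRealCLM.compLp u) : Lp ℂ 2 (volume : Measure ℝ)) k := by
  set û : Lp ℂ 2 (volume : Measure ℝ) := 𝓕 (Complex.ofRealCLM.compLp u) with hû
  have h1 := congrArg 𝓕 h
  rw [TemperedDistribution.fourier_lineDerivOp_eq] at h1
  change (2 * Real.pi * Complex.I) • TemperedDistribution.smulLeftCLM ℂ _
    (𝓕 (Lp.toTemperedDistribution (Complex.ofRealCLM.compLp u))) =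
    𝓕 (Lp.toTemperedDistribution (Complex.ofRealCLM.compLp p)) at h1
  rw [Lp.fourier_toTemperedDistribution_eq, Lp.fourier_toTemperedDistribution_eq, ← hû] at h1
  have hloc : LocallyIntegrable û := (Lp.memLp û).locallyIntegrable (by norm_num)
  apply ae_eq_of_forall_schwartz ((Lp.memLp _).locallyIntegrable (by norm_num))
  · rw [← locallyIntegrableOn_univ] at hloc ⊢
    exact hloc.continuousOn_mul (by fun_prop) isOpen_univ.isLocallyClosed
  · intro φ
    have h2 := DFunLike.congr_fun h1 φ
    rw [Lp.toTemperedDistribution_apply] at h2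
    simp only [smul_eq_mul] at h2
    rw [← h2]
    change (2 * Real.pi * Complex.I) • (TemperedDistribution.smulLeftCLM ℂ _ (û : 𝓢'(ℝ, ℂ)) φ) = _
    rw [TemperedDistribution.smulLeftCLM_apply_apply, Lp.toTemperedDistribution_apply,
      smul_eq_mul, ← integral_const_mul]
    congr 1
    ext k
    rw [SchwartzMap.smulLeftCLM_apply_apply (by fun_prop)]
    simp
    ring

/-- Integration by parts in `H¹`. -/
theorem inner_add_inner_eq_zero_of_weakDeriv {u p w r : Lp ℝ 2 (volume : Measure ℝ)}
    (hu : ∂_{(1 : ℝ)} (realL2Dist u) = realL2Dist p)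
    (hw : ∂_{(1 : ℝ)} (realL2Dist w) = realL2Dist r) :
    inner ℝ r u + inner ℝ w p = 0 := by
  have h : inner ℂ (Complex.ofRealCLM.compLp r) (Complex.ofRealCLM.compLp u) +
      inner ℂ (Complex.ofRealCLM.compLp w) (Complex.ofRealCLM.compLp p) = 0 := by
    rw [← Lp.inner_fourier_eq, ← Lp.inner_fourier_eq (Complex.ofRealCLM.compLp w),
      L2.inner_def, L2.inner_def, ← integral_add (L2.integrable_inner _ _)
      (L2.integrable_inner _ _)]
    -- The symbol `2πik` is purely imaginary, so the two integrands cancel pointwise.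
    apply integral_eq_zero_of_ae
    filter_upwards [fourier_compLp_ae_eq hu, fourier_compLp_ae_eq hw] with k h1 h2
    rw [h1, h2]
    simp [show (starRingEnd ℂ) 2 = 2 from Complex.conj_ofNat 2]
    ring
  rw [inner_compLp_ofReal, inner_compLp_ofReal] at h
  exact_mod_cast h

/-! ### Existence and uniqueness of weak solutions. -/

section LaxMilgram

/-- The Lax-Milgram theorem on a closed subspace of a real Hilbert space. -/
theorem exists_mem_inner_eq_of_coercive {E : Type*} [NormedAddCommGroup E]
    [InnerProductSpace ℝ E] (V : Submodule ℝ E) [CompleteSpace V] (T : E →L[ℝ] E) {δ : ℝ}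
    (hδ : 0 < δ) (hT : ∀ z ∈ V, δ * ‖z‖ * ‖z‖ ≤ inner ℝ (T z) z) (g : E) :
    ∃ z ∈ V, ∀ w ∈ V, inner ℝ (T z) w = inner ℝ g w := by
  let B : V →L[ℝ] V →L[ℝ] ℝ :=
    LinearMap.mkContinuous₂
      (LinearMap.mk₂ ℝ (fun z w : V => inner ℝ (T z) (w : E))
        (fun z z' w => by simp [inner_add_left])
        (fun t z w => by simp [inner_smul_left])
        (fun z w w' => by simp [inner_add_right])
        (fun t z w => by simp [inner_smul_right])) ‖T‖
      (fun z w => (norm_inner_le_norm _ _).trans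
        (mul_le_mul_of_nonneg_right (T.le_opNorm _) (norm_nonneg _)))
  have hco : IsCoercive B := ⟨δ, hδ, fun z => hT z z.2⟩
  let ℓ : V →L[ℝ] ℝ := innerSL ℝ g ∘L V.subtypeL
  let z := hco.continuousLinearEquivOfBilin.symm ((InnerProductSpace.toDual ℝ _).symm ℓ)
  refine ⟨z, z.2, fun w hw => ?_⟩
  change B z ⟨w, hw⟩ = ℓ ⟨w, hw⟩
  rw [← hco.continuousLinearEquivOfBilin_apply, ContinuousLinearEquiv.apply_symm_apply,
    InnerProductSpace.toDual_symm_apply]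

variable (a b c : ℝ →ᵇ ℝ)

/-- The pair `(a u + b p, b u + c p)` for square-integrable `u`, `p`. -/
def symmMatrixMul :
    L2Pair →L[ℝ]
      L2Pair :=
  (WithLp.prodContinuousLinearEquiv 2 ℝ _ _).symm.toContinuousLinearMap ∘L
    ((mulLp a ∘L WithLp.fstL 2 ℝ _ _ + mulLp b ∘L WithLp.sndL 2 ℝ _ _).prod
      (mulLp b ∘L WithLp.fstL 2 ℝ _ _ + mulLp c ∘L WithLp.sndL 2 ℝ _ _))

variable {a b c}

/-- The hypothesis is the pointwise positivity of the coefficient matrix minus `δ`; integrating it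
gives the claim. -/
theorem symmMatrixMul_coercive {δ : ℝ}
    (hδ : ∀ x u p : ℝ, δ * (u ^ 2 + p ^ 2) ≤ a x * u ^ 2 + 2 * b x * u * p + c x * p ^ 2)
    (z : L2Pair) :
    δ * ‖z‖ * ‖z‖ ≤ inner ℝ (symmMatrixMul a b c z) z := by
  have h0 : 0 ≤ inner ℝ (symmMatrixMul a b c z - δ • z) z := by
    rw [WithLp.prod_inner_apply, L2.inner_def, L2.inner_def,
      ← integral_add (L2.integrable_inner _ _) (L2.integrable_inner _ _)]
    apply integral_nonneg_of_ae
    change ∀ᵐ x, 0 ≤ inner ℝ ((mulLp a z.fst + mulLp b z.snd - δ • z.fst :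
        Lp ℝ 2 (volume : Measure ℝ)) x) (z.fst x) +
      inner ℝ ((mulLp b z.fst + mulLp c z.snd - δ • z.snd : Lp ℝ 2 (volume : Measure ℝ)) x)
        (z.snd x)
    filter_upwards [Lp.coeFn_sub (mulLp a z.fst + mulLp b z.snd) (δ • z.fst),
      Lp.coeFn_add (mulLp a z.fst) (mulLp b z.snd), Lp.coeFn_smul δ z.fst,
      Lp.coeFn_sub (mulLp b z.fst + mulLp c z.snd) (δ • z.snd),
      Lp.coeFn_add (mulLp b z.fst) (mulLp c z.snd), Lp.coeFn_smul δ z.snd,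
      coeFn_mulLp a z.fst, coeFn_mulLp b z.snd, coeFn_mulLp b z.fst, coeFn_mulLp c z.snd]
      with x h1 h2 h3 h4 h5 h6 h7 h8 h9 h10
    simp only [h1, h2, h3, h4, h5, h6, h7, h8, h9, h10, Pi.sub_apply, Pi.add_apply, Pi.smul_apply]
    simp
    nlinarith [hδ x (z.fst x) (z.snd x)]
  rw [inner_sub_left, real_inner_smul_left, real_inner_self_eq_norm_mul_norm] at h0
  linarith

/-- Solvability of the weak form of `(a u + b u_x) - (b u + c u_x)_x = g₀ + (g₁)_x` for uniformly
positive definite coefficients. -/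
theorem exists_weak_solution {δ : ℝ} (hδ0 : 0 < δ)
    (hδ : ∀ x u p : ℝ, δ * (u ^ 2 + p ^ 2) ≤ a x * u ^ 2 + 2 * b x * u * p + c x * p ^ 2)
    (g₀ g₁ : Lp ℝ 2 (volume : Measure ℝ)) :
    ∃ u p : Lp ℝ 2 (volume : Measure ℝ), ∂_{(1 : ℝ)} (realL2Dist u) = realL2Dist p ∧
      realL2Dist (mulLp a u + mulLp b p) - ∂_{(1 : ℝ)} (realL2Dist (mulLp b u + mulLp c p)) =
        realL2Dist g₀ + ∂_{(1 : ℝ)} (realL2Dist g₁) := by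
  -- The sign of `-g₁` comes from moving the derivative onto the test function.
  obtain ⟨z, hzV, hz⟩ := exists_mem_inner_eq_of_coercive weakDerivGraph (symmMatrixMul a b c) hδ0
    (fun z _ => symmMatrixMul_coercive hδ z) (WithLp.toLp 2 (g₀, -g₁))
  refine ⟨z.fst, z.snd, mem_weakDerivGraph.mp hzV, ?_⟩
  apply tempered_ext_real
  intro φ
  have h := hz _ (toLp_mem_weakDerivGraph φ)
  rw [WithLp.prod_inner_apply, WithLp.prod_inner_apply] at h
  change inner ℝ (mulLp a z.fst + mulLp b z.snd) (φ.toLp 2) +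
    inner ℝ (mulLp b z.fst + mulLp c z.snd) ((∂_{(1 : ℝ)} φ).toLp 2) =
    inner ℝ g₀ (φ.toLp 2) + inner ℝ (-g₁) ((∂_{(1 : ℝ)} φ).toLp 2) at h
  change realL2Dist _ (schwartzOfReal φ) - (∂_{(1 : ℝ)} (realL2Dist _)) (schwartzOfReal φ) =
    realL2Dist _ (schwartzOfReal φ) + (∂_{(1 : ℝ)} (realL2Dist _)) (schwartzOfReal φ)
  rw [TemperedDistribution.lineDerivOp_apply_apply, TemperedDistribution.lineDerivOp_apply_apply,
    deriv_schwartzOfReal, map_neg, map_neg, realL2Dist_apply_schwartzOfReal,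
    realL2Dist_apply_schwartzOfReal, realL2Dist_apply_schwartzOfReal,
    realL2Dist_apply_schwartzOfReal, sub_neg_eq_add]
  rw [inner_neg_left] at h
  exact_mod_cast h

/-- Uniqueness for the homogeneous equation `(a u + b u_x) - (b u + c u_x)_x = 0`. -/
theorem eq_zero_of_weak_solution {δ : ℝ} (hδ0 : 0 < δ)
    (hδ : ∀ x u p : ℝ, δ * (u ^ 2 + p ^ 2) ≤ a x * u ^ 2 + 2 * b x * u * p + c x * p ^ 2)
    {u p : Lp ℝ 2 (volume : Measure ℝ)} (hup : ∂_{(1 : ℝ)} (realL2Dist u) = realL2Dist p)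
    (h : realL2Dist (mulLp a u + mulLp b p) -
      ∂_{(1 : ℝ)} (realL2Dist (mulLp b u + mulLp c p)) = 0) : u = 0 := by
  -- By the equation the flux `b u + c p` has weak derivative `a u + b p`, so pairing with `u` gives
  -- zero energy.
  have h1 := inner_add_inner_eq_zero_of_weakDeriv hup (sub_eq_zero.mp h).symm
  let z : L2Pair :=
    WithLp.toLp 2 (u, p)
  have h2 := symmMatrixMul_coercive hδ z
  rw [WithLp.prod_inner_apply] at h2
  change δ * ‖z‖ * ‖z‖ ≤ inner ℝ (mulLp a u + mulLp b p) u +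
    inner ℝ (mulLp b u + mulLp c p) p at h2
  rw [h1, mul_assoc] at h2
  have hz : ‖z‖ = 0 := by
    have := nonpos_of_mul_nonpos_right h2 hδ0
    nlinarith [norm_nonneg z]
  have hz0 : z = 0 := norm_eq_zero.mp hz
  exact congrArg (fun z : L2Pair => z.fst) hz0

end LaxMilgram

/-! ### Data in `H^{-1}` and Sobolev classes of bounded continuous functions. -/

/-- Real distributions in `H^{-1}` are of the form `g₀ + (g₁)_x` with real `g₀`, `g₁` in `L²`. -/
theorem exists_eq_add_lineDeriv {f : 𝓢'(ℝ, ℂ)} (hf : TemperedDistribution.MemSobolev (-1) 2 f)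
    (hr : IsRealDistribution f) : ∃ g₀ g₁ : Lp ℝ 2 (volume : Measure ℝ),
      f = realL2Dist g₀ + ∂_{(1 : ℝ)} (realL2Dist g₁) := by
  open TemperedDistribution in
  -- `G ∈ H¹` and `f = G - (2π)⁻² G''`, so `G` and `-(2π)⁻² G'` serve, up to taking real parts.
  let G : 𝓢'(ℝ, ℂ) := besselPotential ℝ ℂ (-2) f
  have hG : MemSobolev 1 2 G := by
    rw [memSobolev_besselPotential_iff]
    convert hf using 1
    norm_num
  have hGf : f = G - (((2 * Real.pi) ^ 2)⁻¹ : ℝ) • ∂_{(1 : ℝ)} (∂_{(1 : ℝ)} G) := by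
    rw [← besselPotential_two_eq]
    simp [G]
  obtain ⟨F₀, hF₀⟩ := memSobolev_zero_iff.mp (hG.mono zero_le_one)
  have hG' : MemSobolev 0 2 (∂_{(1 : ℝ)} G) := by
    simpa using hG.lineDerivOp (m := 1)
  obtain ⟨F₁, hF₁⟩ := memSobolev_zero_iff.mp (hG'.smul (-(((2 * Real.pi) ^ 2)⁻¹ : ℝ) : ℂ))
  have hf2 : f = (F₀ : 𝓢'(ℝ, ℂ)) + ∂_{(1 : ℝ)} (F₁ : 𝓢'(ℝ, ℂ)) := by
    rw [← hF₁, ← hF₀, LineDeriv.lineDerivOp_smul, neg_smul, ← sub_eq_add_neg]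
    exact hGf
  refine ⟨Complex.reCLM.compLp F₀, Complex.reCLM.compLp F₁, tempered_ext_real fun φ => ?_⟩
  have him := IsRealDistribution.iff_forall_schwartzOfReal.mp hr φ
  have hre : f (schwartzOfReal φ) = ((f (schwartzOfReal φ)).re : ℂ) :=
    Complex.ext rfl (by simp [him])
  rw [hre, hf2]
  change ((((F₀ : 𝓢'(ℝ, ℂ)) (schwartzOfReal φ)) +
    (∂_{(1 : ℝ)} (F₁ : 𝓢'(ℝ, ℂ))) (schwartzOfReal φ)).re : ℂ) =
    realL2Dist _ (schwartzOfReal φ) + (∂_{(1 : ℝ)} (realL2Dist _)) (schwartzOfReal φ)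
  rw [lineDerivOp_apply_apply, lineDerivOp_apply_apply, deriv_schwartzOfReal, map_neg, map_neg,
    realL2Dist_re_apply, realL2Dist_re_apply]
  simp

open TemperedDistribution RealSobolev

/-- The bounded continuous function `f` belongs to `H^r`. -/
def InSobolev (r : ℝ) (f : ℝ →ᵇ ℝ) : Prop := MemSobolev r 2 f.toDist

namespace InSobolev

variable {r : ℝ} {f g h : ℝ →ᵇ ℝ}

theorem mono {r' : ℝ} (hr : r' ≤ r) (hf : InSobolev r f) : InSobolev r' f := MemSobolev.mono hr hf

theorem add (hf : InSobolev r f) (hg : InSobolev r g) : InSobolev r (f + g) := by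
  rw [InSobolev, BoundedContinuousFunction.toDist_add]
  exact MemSobolev.add hf hg

theorem smul (c : ℝ) (hf : InSobolev r f) : InSobolev r (c • f) := by
  rw [InSobolev, BoundedContinuousFunction.toDist_smul]
  exact MemSobolev.smul (c : ℂ) hf

theorem sub (hf : InSobolev r f) (hg : InSobolev r g) : InSobolev r (f - g) := by
  rw [sub_eq_add_neg, ← neg_one_smul ℝ g]
  exact hf.add (hg.smul _)

theorem exists_rep_eq (hr : 1 / 2 < r) (hf : InSobolev r f) : ∃ u : RealSobolev r, rep hr u = f :=
  ⟨ofDist f.toDist hf f.toDist_isReal, rep_eq_of_toDist_eq hr rfl⟩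

theorem _root_.RealSobolev.inSobolev_rep (hr : 1 / 2 < r) (u : RealSobolev r) :
    InSobolev r (rep hr u) := by
  rw [InSobolev, toDist_rep]
  exact memSobolev u

theorem mul (hr : 1 / 2 < r) (hf : InSobolev r f) (hg : InSobolev r g) : InSobolev r (f * g) := by
  obtain ⟨u, rfl⟩ := hf.exists_rep_eq hr
  obtain ⟨v, rfl⟩ := hg.exists_rep_eq hr
  rw [← rep_mul]
  exact inSobolev_rep hr _

theorem mul_left (hr : 1 / 2 < r) (hh : InSobolev r (h - 1)) (hg : InSobolev r g) :
    InSobolev r (h * g) := by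
  have : h * g = (h - 1) * g + g := by ring
  rw [this]
  exact (hh.mul hr hg).add hg

theorem exists_div (hr : 1 / 2 < r) (hh : InSobolev r (h - 1)) {m : ℝ} (hm : 0 < m)
    (hmh : ∀ x, m ≤ h x) (hg : InSobolev r g) : ∃ f, InSobolev r f ∧ h * f = g := by
  obtain ⟨η, hη⟩ := hh.exists_rep_eq hr
  obtain ⟨u, rfl⟩ := hg.exists_rep_eq hr
  obtain ⟨v, hv⟩ := RealSobolev.exists_div hr (h := h) (η := η) (by rw [hη]; ring) hm hmh u
  exact ⟨_, inSobolev_rep hr v, hv⟩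

theorem exists_div_cube (hr : 1 / 2 < r) (hh : InSobolev r (h - 1)) {m : ℝ} (hm : 0 < m)
    (hmh : ∀ x, m ≤ h x) (hg : InSobolev r g) :
    ∃ f, InSobolev r f ∧ ∀ x, h x ^ 3 * f x = g x := by
  obtain ⟨f₁, hf₁, hf₁'⟩ := exists_div hr hh hm hmh hg
  obtain ⟨f₂, hf₂, hf₂'⟩ := exists_div hr hh hm hmh hf₁
  obtain ⟨f₃, hf₃, hf₃'⟩ := exists_div hr hh hm hmh hf₂
  refine ⟨f₃, hf₃, fun x => ?_⟩
  rw [← hf₁', ← hf₂', ← hf₃']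
  simp only [BoundedContinuousFunction.coe_mul, Pi.mul_apply]
  ring

theorem third_cube_mul (hr : 1 / 2 < r) (hh : InSobolev r (h - 1)) (hg : InSobolev r g) :
    InSobolev r ((1 / 3 : ℝ) • h ^ 3 * g) := by
  have : (1 / 3 : ℝ) • h ^ 3 * g = (1 / 3 : ℝ) • (h * (h * (h * g))) := by
    rw [smul_mul_assoc, pow_three, mul_assoc, mul_assoc]
  rw [this]
  exact smul _ (mul_left hr hh (mul_left hr hh (mul_left hr hh hg)))

theorem coeff_mul_add {a b u p : ℝ →ᵇ ℝ} (hr : 1 / 2 < r) (hh : InSobolev r (h - 1))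
    (ha : InSobolev r (a - h)) (hb : InSobolev r b) (hu : InSobolev r u) (hp : InSobolev r p) :
    InSobolev r (a * u + b * p) := by
  rw [← sub_add_cancel a h, add_mul]
  exact add (add (mul hr ha hu) (mul_left hr hh hu)) (mul hr hb hp)

theorem mul_add_third_cube_mul {b c u p : ℝ →ᵇ ℝ} (hr : 1 / 2 < r) (hh : InSobolev r (h - 1))
    (hb : InSobolev r b) (hc : c = (1 / 3 : ℝ) • h ^ 3) (hu : InSobolev r u)
    (hp : InSobolev r p) : InSobolev r (b * u + c * p) := by
  rw [hc]
  exact add (mul hr hb hu) (third_cube_mul hr hh hp)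

end InSobolev

theorem realL2Dist_eq_toDist {u : Lp ℝ 2 (volume : Measure ℝ)} {f : ℝ →ᵇ ℝ}
    (h : u =ᵐ[volume] f) : realL2Dist u = f.toDist := by
  ext φ
  rw [realL2Dist_apply, BoundedContinuousFunction.toDist_apply]
  apply integral_congr_ae
  filter_upwards [h] with x hx
  rw [hx]

theorem ae_eq_of_realL2Dist_eq_toDist {u : Lp ℝ 2 (volume : Measure ℝ)} {f : ℝ →ᵇ ℝ}
    (h : realL2Dist u = f.toDist) : u =ᵐ[volume] f := by
  apply ae_eq_of_forall_schwartz_real (memLp_two_locallyIntegrable u)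
    f.continuous.locallyIntegrable
  intro φ
  rw [← realL2Dist_apply, h, BoundedContinuousFunction.toDist_apply]

theorem exists_ae_eq_of_memSobolev {r : ℝ} (hr : 1 / 2 < r) {u : Lp ℝ 2 (volume : Measure ℝ)}
    (hu : MemSobolev r 2 (realL2Dist u)) : ∃ f : ℝ →ᵇ ℝ, InSobolev r f ∧ u =ᵐ[volume] f := by
  let v : RealSobolev r := ofDist _ hu (realL2Dist_isReal u)
  exact ⟨rep hr v, inSobolev_rep hr v, ae_eq_of_realL2Dist_eq_toDist (toDist_rep hr v).symm⟩

theorem mulLp_add_mulLp_ae_eq {a b f g : ℝ →ᵇ ℝ} {u p : Lp ℝ 2 (volume : Measure ℝ)}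
    (hu : u =ᵐ[volume] f) (hp : p =ᵐ[volume] g) :
    (mulLp a u + mulLp b p : Lp ℝ 2 (volume : Measure ℝ)) =ᵐ[volume]
      (a * f + b * g : ℝ →ᵇ ℝ) := by
  filter_upwards [Lp.coeFn_add (mulLp a u) (mulLp b p), coeFn_mulLp a u, coeFn_mulLp b p, hu, hp]
    with x h1 h2 h3 h4 h5
  rw [h1, Pi.add_apply, h2, h3, h4, h5]
  rfl

/-! ### Regularity bootstrap. -/

section Regularity

variable {s : ℝ} {h a b c : ℝ →ᵇ ℝ} {u p : Lp ℝ 2 (volume : Measure ℝ)}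

/-- One step of the regularity argument. -/
theorem memSobolev_step (hs : 1 / 2 < s) (hh : InSobolev s (h - 1)) {m : ℝ} (hm : 0 < m)
    (hmh : ∀ x, m ≤ h x) (hb : InSobolev s b) (hc : c = (1 / 3 : ℝ) • h ^ 3)
    (hup : ∂_{(1 : ℝ)} (realL2Dist u) = realL2Dist p) {r : ℝ} (hr0 : 0 ≤ r)
    (hu : MemSobolev (r + 1) 2 (realL2Dist u))
    (hz : MemSobolev r 2 (realL2Dist (mulLp a u + mulLp b p)))
    (hw : MemSobolev r 2 (realL2Dist (mulLp b u + mulLp c p)))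
    (hf : MemSobolev (s - 1) 2 (realL2Dist (mulLp a u + mulLp b p) -
      ∂_{(1 : ℝ)} (realL2Dist (mulLp b u + mulLp c p)))) :
    MemSobolev (min s (r + 1) + 1) 2 (realL2Dist u) := by
  set t := min s (r + 1) with ht
  have ht2 : 1 / 2 < t := lt_min hs (by linarith)
  have hts : t ≤ s := min_le_left _ _
  have htr : t ≤ r + 1 := min_le_right _ _
  have hw' : MemSobolev t 2 (realL2Dist (mulLp b u + mulLp c p)) := by
    have h1 : MemSobolev (t - 1 + 1) 2 (realL2Dist (mulLp b u + mulLp c p)) := by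
      refine MemSobolev.add_one (hw.mono (by linarith)) ?_
      -- `w_x = (a u + b p) - f`, where the first term has order `r ≥ t - 1` and `f` has order `s -
      -- 1 ≥ t - 1`.
      have := (hz.mono (s' := t - 1) (by linarith)).sub (hf.mono (s' := t - 1) (by linarith))
      simpa using this
    simpa using h1
  obtain ⟨w₀, hw₀, hww⟩ := exists_ae_eq_of_memSobolev ht2 hw'
  obtain ⟨u₀, hu₀, huu⟩ := exists_ae_eq_of_memSobolev ht2 (hu.mono htr)
  have hht : InSobolev t (h - 1) := hh.mono hts
  -- Solving `w = b u + ⅓h³p` for `p` gives `h³p = 3(w - b u)`.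
  have hG : InSobolev t ((3 : ℝ) • (w₀ - b * u₀)) :=
    (hw₀.sub ((hb.mono hts).mul ht2 hu₀)).smul 3
  obtain ⟨f, hf₁, hf₂⟩ := InSobolev.exists_div_cube ht2 hht hm hmh hG
  have hp : p =ᵐ[volume] f := by
    filter_upwards [hww, huu, Lp.coeFn_add (mulLp b u) (mulLp c p), coeFn_mulLp b u,
      coeFn_mulLp c p] with x h1 h2 h3 h4 h5
    have e : h x ^ 3 * f x = 3 * (w₀ x - b x * u₀ x) := hf₂ x
    have hx : 0 < h x := hm.trans_le (hmh x)
    have hcx : c x = 1 / 3 * h x ^ 3 := by rw [hc]; rfl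
    rw [h3, Pi.add_apply, h4, h5, hcx] at h1
    rw [← h1, h2] at e
    have h6 : h x ^ 3 * (p x - f x) = 0 := by linarith
    have h7 := (mul_eq_zero.mp h6).resolve_left (by positivity)
    linarith
  apply MemSobolev.add_one (hu.mono htr)
  rw [hup, realL2Dist_eq_toDist hp]
  exact hf₁

/-- Regularity of weak solutions. -/
theorem memSobolev_of_weak_solution (hs : 1 / 2 < s) (hh : InSobolev s (h - 1)) {m : ℝ}
    (hm : 0 < m) (hmh : ∀ x, m ≤ h x) (hb : InSobolev s b) (hc : c = (1 / 3 : ℝ) • h ^ 3)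
    (ha : InSobolev s (a - h))
    (hup : ∂_{(1 : ℝ)} (realL2Dist u) = realL2Dist p)
    (hf : MemSobolev (s - 1) 2 (realL2Dist (mulLp a u + mulLp b p) -
      ∂_{(1 : ℝ)} (realL2Dist (mulLp b u + mulLp c p)))) :
    MemSobolev (s + 1) 2 (realL2Dist u) := by
  have key (j : ℕ) : MemSobolev (min s j + 1) 2 (realL2Dist u) := by
    induction j with
    | zero =>
      have h0 : min s ((0 : ℕ) : ℝ) = 0 := by simp; linarith
      rw [h0]
      apply MemSobolev.add_one (realL2Dist_memSobolev u)
      rw [hup]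
      exact realL2Dist_memSobolev p
    | succ j ih =>
      have hr0 : 0 ≤ min s (j : ℝ) := le_min (by linarith) (Nat.cast_nonneg j)
      have hj : min s ((j + 1 : ℕ) : ℝ) = min s (min s (j : ℝ) + 1) := by
        push_cast
        rw [← min_add_add_right, ← min_assoc, min_eq_left (by linarith : s ≤ s + 1)]
      rw [hj]
      obtain ⟨hz, hw⟩ : MemSobolev (min s (j : ℝ)) 2 (realL2Dist (mulLp a u + mulLp b p)) ∧
          MemSobolev (min s (j : ℝ)) 2 (realL2Dist (mulLp b u + mulLp c p)) := by
        -- At order zero there is no algebra property, but bounded coefficients preserve `L²`; from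
        -- `j = 1` on the order exceeds `1/2`.
        rcases Nat.eq_zero_or_pos j with rfl | hj0
        · have h0 : min s ((0 : ℕ) : ℝ) = 0 := by simp; linarith
          rw [h0]
          exact ⟨realL2Dist_memSobolev _, realL2Dist_memSobolev _⟩
        · have hr : 1 / 2 < min s (j : ℝ) := by
            refine lt_min hs ?_
            have : (1 : ℝ) ≤ j := by exact_mod_cast hj0
            linarith
          have hrs : min s (j : ℝ) ≤ s := min_le_left _ _
          have hht := hh.mono hrs
          obtain ⟨u₀, hu₀, huu⟩ := exists_ae_eq_of_memSobolev hr (ih.mono (by linarith))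
          have hp : MemSobolev (min s (j : ℝ)) 2 (realL2Dist p) := by
            rw [← hup]
            simpa using ih.lineDerivOp (m := 1)
          obtain ⟨p₀, hp₀, hpp⟩ := exists_ae_eq_of_memSobolev hr hp
          rw [realL2Dist_eq_toDist (mulLp_add_mulLp_ae_eq huu hpp),
            realL2Dist_eq_toDist (mulLp_add_mulLp_ae_eq huu hpp)]
          exact ⟨InSobolev.coeff_mul_add hr hht (ha.mono hrs) (hb.mono hrs) hu₀ hp₀,
            InSobolev.mul_add_third_cube_mul hr hht (hb.mono hrs) hc hu₀ hp₀⟩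
      exact memSobolev_step hs hh hm hmh hb hc hup hr0 ih hz hw hf
  have hmin : min s (⌈s⌉₊ : ℝ) = s := min_eq_left (Nat.le_ceil s)
  have := key ⌈s⌉₊
  rwa [hmin] at this

end Regularity

/-! ### The isomorphism theorem. -/

namespace RealSobolev

variable {s : ℝ}

/-- The distributional derivative as a continuous linear map. -/
def dxL : RealSobolev s →L[ℝ] RealSobolev (s - 1) where
  toFun := dx
  map_add' u v := toDist_injective (by
    rw [toDist_dx, map_add, map_add, toDist_dx, toDist_dx, LineDeriv.lineDerivOp_add])
  map_smul' c u := toDist_injective (by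
    rw [toDist_dx, map_smul, RingHom.id_apply, map_smul, toDist_dx, LineDeriv.lineDerivOp_smul])
  cont := by
    let L : RealSobolev s →ₗ[ℝ] RealSobolev (s - 1) :=
      { toFun := dx
        map_add' := fun u v => toDist_injective (by
          rw [toDist_dx, map_add, map_add, toDist_dx, toDist_dx, LineDeriv.lineDerivOp_add])
        map_smul' := fun c u => toDist_injective (by
          rw [toDist_dx, map_smul, RingHom.id_apply, map_smul, toDist_dx,
            LineDeriv.lineDerivOp_smul]) }
    refine continuous_of_comp_continuous L toDist continuous_toDist toDist_injective ?_
    exact (LineDeriv.lineDerivOpCLM ℂ 𝓢'(ℝ, ℂ) (1 : ℝ)).continuous.comp continuous_toDist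

/-- The distribution `(a u + b u_x) - (b u + c u_x)_x` for bounded continuous coefficients. -/
def divFormL (hs : 1 / 2 < s) (a b c : ℝ →ᵇ ℝ) : RealSobolev (s + 1) →L[ℝ] 𝓢'(ℝ, ℂ) :=
  let R₀ : RealSobolev (s + 1) →L[ℝ] (ℝ →ᵇ ℝ) := repL (by linarith : 1 / 2 < s + 1)
  let R₁ : RealSobolev (s + 1) →L[ℝ] (ℝ →ᵇ ℝ) := repL (by linarith : 1 / 2 < s + 1 - 1) ∘L dxL
  let M : (ℝ →ᵇ ℝ) →L[ℝ] (ℝ →ᵇ ℝ) →L[ℝ] (ℝ →ᵇ ℝ) := ContinuousLinearMap.mul ℝ (ℝ →ᵇ ℝ)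
  BoundedContinuousFunction.toDistL ∘L (M a ∘L R₀ + M b ∘L R₁) -
    (LineDeriv.lineDerivOpCLM ℂ 𝓢'(ℝ, ℂ) (1 : ℝ)).restrictScalars ℝ ∘L
      BoundedContinuousFunction.toDistL ∘L (M b ∘L R₀ + M c ∘L R₁)

theorem divFormL_apply (hs : 1 / 2 < s) (a b c : ℝ →ᵇ ℝ) (u : RealSobolev (s + 1)) :
    divFormL hs a b c u =
      (a * rep (by linarith : 1 / 2 < s + 1) u +
        b * rep (by linarith : 1 / 2 < s + 1 - 1) (dx u)).toDist -
      ∂_{(1 : ℝ)} (b * rep (by linarith : 1 / 2 < s + 1) u +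
        c * rep (by linarith : 1 / 2 < s + 1 - 1) (dx u)).toDist := rfl

/-- Both first-order terms carry the same coefficient `-½h²ξ_x`, which makes the form symmetric. -/
theorem opA_eq_divFormL (hs : 1 / 2 < s) (h : ℝ →ᵇ ℝ) (ξ : RealSobolev (s + 3))
    {ξx : ℝ →ᵇ ℝ} (hξ : ξx = rep (by linarith : 1 / 2 < s + 3 - 1) (dx ξ))
    (u : RealSobolev (s + 1)) :
    opA hs h ξ u = divFormL hs (h * (1 + ξx ^ 2)) (-(1 / 2 : ℝ) • (h ^ 2 * ξx))
      ((1 / 3 : ℝ) • h ^ 3) u := by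
  subst hξ
  rw [divFormL_apply, opA]
  simp only [BoundedContinuousFunction.toDist_add, LineDeriv.lineDerivOp_add, smul_mul_assoc,
    BoundedContinuousFunction.toDist_smul, LineDeriv.lineDerivOp_smul]
  module

theorem divFormL_eq_realL2Dist (hs : 1 / 2 < s) (a b c : ℝ →ᵇ ℝ) {U : RealSobolev (s + 1)}
    {u p : Lp ℝ 2 (volume : Measure ℝ)} (hu : realL2Dist u = toDist U)
    (hp : realL2Dist p = toDist (dx U)) :
    divFormL hs a b c U = realL2Dist (mulLp a u + mulLp b p) -
      ∂_{(1 : ℝ)} (realL2Dist (mulLp b u + mulLp c p)) := by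
  have hu' := ae_eq_of_realL2Dist_eq_toDist
    (hu.trans (toDist_rep (by linarith : 1 / 2 < s + 1) U).symm)
  have hp' := ae_eq_of_realL2Dist_eq_toDist
    (hp.trans (toDist_rep (by linarith : 1 / 2 < s + 1 - 1) (dx U)).symm)
  rw [divFormL_apply, realL2Dist_eq_toDist (mulLp_add_mulLp_ae_eq hu' hp'),
    realL2Dist_eq_toDist (mulLp_add_mulLp_ae_eq hu' hp')]

theorem divFormL_isReal (hs : 1 / 2 < s) (a b c : ℝ →ᵇ ℝ) (u : RealSobolev (s + 1)) :
    IsRealDistribution (divFormL hs a b c u) := by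
  rw [divFormL_apply]
  exact (BoundedContinuousFunction.toDist_isReal _).sub
    (BoundedContinuousFunction.toDist_isReal _).lineDerivOp

theorem divFormL_memSobolev (hs : 1 / 2 < s) {h a b c : ℝ →ᵇ ℝ} (hh : InSobolev s (h - 1))
    (ha : InSobolev s (a - h)) (hb : InSobolev s b) (hc : c = (1 / 3 : ℝ) • h ^ 3)
    (u : RealSobolev (s + 1)) : MemSobolev (s - 1) 2 (divFormL hs a b c u) := by
  rw [divFormL_apply]
  have hu : InSobolev s (rep (by linarith : 1 / 2 < s + 1) u) :=
    (inSobolev_rep _ u).mono (by linarith)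
  have hp : InSobolev s (rep (by linarith : 1 / 2 < s + 1 - 1) (dx u)) :=
    (inSobolev_rep _ (dx u)).mono (by linarith)
  exact MemSobolev.sub
    (InSobolev.mono (by linarith) (InSobolev.coeff_mul_add hs hh ha hb hu hp))
    (MemSobolev.lineDerivOp (InSobolev.mul_add_third_cube_mul hs hh hb hc hu hp))

/-- A uniformly elliptic operator in divergence form is an isomorphism `H^{s+1} ≃ H^{s-1}`. -/
theorem exists_divForm_equiv (hs : 1 / 2 < s) {h a b c : ℝ →ᵇ ℝ} (hh : InSobolev s (h - 1))
    {m : ℝ} (hm : 0 < m) (hmh : ∀ x, m ≤ h x) (ha : InSobolev s (a - h)) (hb : InSobolev s b)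
    (hc : c = (1 / 3 : ℝ) • h ^ 3) {δ : ℝ} (hδ0 : 0 < δ)
    (hδ : ∀ x u p : ℝ, δ * (u ^ 2 + p ^ 2) ≤ a x * u ^ 2 + 2 * b x * u * p + c x * p ^ 2) :
    ∃ A : RealSobolev (s + 1) ≃L[ℝ] RealSobolev (s - 1),
      ∀ u, toDist (A u) = divFormL hs a b c u := by
  let L : RealSobolev (s + 1) →ₗ[ℝ] RealSobolev (s - 1) :=
    { toFun := fun u => ofDist (divFormL hs a b c u) (divFormL_memSobolev hs hh ha hb hc u)
        (divFormL_isReal hs a b c u)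
      map_add' := fun u v => toDist_injective ((divFormL hs a b c).map_add u v)
      map_smul' := fun t u => toDist_injective ((divFormL hs a b c).map_smul t u) }
  have hL (u : RealSobolev (s + 1)) : toDist (L u) = divFormL hs a b c u := rfl
  have hcont : Continuous L :=
    continuous_of_comp_continuous L toDist continuous_toDist toDist_injective
      (divFormL hs a b c).continuous
  have hinj : LinearMap.ker L = ⊥ := by
    rw [LinearMap.ker_eq_bot']
    intro U hU
    obtain ⟨u, hu⟩ := exists_realL2Dist_eq ((memSobolev U).mono (by linarith : (0 : ℝ) ≤ s + 1))
      (isReal U)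
    obtain ⟨p, hp⟩ := exists_realL2Dist_eq
      ((memSobolev (dx U)).mono (by linarith : (0 : ℝ) ≤ s + 1 - 1)) (isReal (dx U))
    have h1 := hL U
    rw [hU, map_zero, divFormL_eq_realL2Dist hs a b c hu hp] at h1
    have hup : ∂_{(1 : ℝ)} (realL2Dist u) = realL2Dist p := by rw [hu, hp, toDist_dx]
    have h0 := eq_zero_of_weak_solution hδ0 hδ hup h1.symm
    apply toDist_injective
    rw [← hu, h0, map_zero, map_zero]
  have hsurj : LinearMap.range L = ⊤ := by
    rw [LinearMap.range_eq_top]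
    intro f
    -- `s > 1/2` puts `H^{s-1}` inside `H^{-1}`, where Lax-Milgram applies.
    obtain ⟨g₀, g₁, hg⟩ := exists_eq_add_lineDeriv
      ((memSobolev f).mono (by linarith : (-1 : ℝ) ≤ s - 1)) (isReal f)
    obtain ⟨u, p, hup, h1⟩ := exists_weak_solution hδ0 hδ g₀ g₁
    rw [← hg] at h1
    have hreg := memSobolev_of_weak_solution hs hh hm hmh hb hc ha hup
      (by rw [h1]; exact memSobolev f)
    refine ⟨ofDist (realL2Dist u) hreg (realL2Dist_isReal u), toDist_injective ?_⟩
    rw [hL, divFormL_eq_realL2Dist hs a b c (u := u) (p := p) (toDist_ofDist _ _ _).symm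
      (by rw [toDist_dx, toDist_ofDist, hup]), h1]
  exact ⟨ContinuousLinearEquiv.ofBijective ⟨L, hcont⟩ hinj hsurj, fun u => rfl⟩

end RealSobolev

/-- The square `h(ξu - hp/2)²` absorbs the cross term at the cost of `h³p²/4`; the remainder is `1/3
- 1/4 = 1/12`. -/
theorem quadratic_form_lower_bound {m h ξ : ℝ} (hm : 0 < m) (hmh : m ≤ h) (u p : ℝ) :
    min m (m ^ 3 / 12) * (u ^ 2 + p ^ 2) ≤
      h * (1 + ξ ^ 2) * u ^ 2 + 2 * (-(1 / 2) * (h ^ 2 * ξ)) * u * p + 1 / 3 * h ^ 3 * p ^ 2 := by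
  have h0 : 0 ≤ h := hm.le.trans hmh
  have h3 : m ^ 3 ≤ h ^ 3 := by gcongr
  calc min m (m ^ 3 / 12) * (u ^ 2 + p ^ 2)
      = min m (m ^ 3 / 12) * u ^ 2 + min m (m ^ 3 / 12) * p ^ 2 := by ring
    _ ≤ h * u ^ 2 + h ^ 3 / 12 * p ^ 2 := by
      gcongr
      · exact (min_le_left _ _).trans hmh
      · exact (min_le_right _ _).trans (by linarith)
    _ ≤ h * u ^ 2 + h ^ 3 / 12 * p ^ 2 + h * (ξ * u - h * p / 2) ^ 2 :=
      le_add_of_nonneg_right (by positivity)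
    _ = _ := by ring

theorem mainTheorem2 (s : ℝ) (hs : 1 / 2 < s) (ξ : RealSobolev (s + 3)) (h : ℝ →ᵇ ℝ)
    (hh : ∃ η : RealSobolev s, h = 1 + RealSobolev.rep hs η) (hpos : 0 < ⨅ x, h x) :
    ∃ A : RealSobolev (s + 1) ≃L[ℝ] RealSobolev (s - 1),
      ∀ u : RealSobolev (s + 1), (A u).toDist = RealSobolev.opA hs h ξ u := by
  obtain ⟨η, hη⟩ := hh
  have hmh (x : ℝ) : ⨅ x, h x ≤ h x := by
    refine ciInf_le ⟨-‖h‖, ?_⟩ x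
    rintro _ ⟨y, rfl⟩
    exact (abs_le.mp (h.norm_coe_le_norm y)).1
  have hh1 : InSobolev s (h - 1) := by
    rw [hη, add_sub_cancel_left]
    exact RealSobolev.inSobolev_rep hs η
  obtain ⟨ξx, hξx⟩ : ∃ ξx, ξx = RealSobolev.rep (by linarith : 1 / 2 < s + 3 - 1)
    (RealSobolev.dx ξ) := ⟨_, rfl⟩
  have hξ : InSobolev s ξx := by
    rw [hξx]
    exact (RealSobolev.inSobolev_rep _ _).mono (by linarith)
  have ha : InSobolev s (h * (1 + ξx ^ 2) - h) := by
    have : h * (1 + ξx ^ 2) - h = h * (ξx * ξx) := by ring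
    rw [this]
    exact InSobolev.mul_left hs hh1 (hξ.mul hs hξ)
  have hb : InSobolev s (-(1 / 2 : ℝ) • (h ^ 2 * ξx)) := by
    rw [sq, mul_assoc]
    exact (InSobolev.mul_left hs hh1 (InSobolev.mul_left hs hh1 hξ)).smul _
  obtain ⟨A, hA⟩ := RealSobolev.exists_divForm_equiv hs hh1 hpos hmh ha hb rfl
    (lt_min hpos (by positivity)) (fun x u p => quadratic_form_lower_bound hpos (hmh x) u p)
  exact ⟨A, fun u => by rw [RealSobolev.opA_eq_divFormL hs h ξ hξx, hA]⟩

end
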